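/- Let $(R,\mathfrak m,k)$ be a commutative Noetherian local ring of Krull dimension $d$ that is Cohen-Macaulay and has minimal multiplicity, i.e. $e(R)=\mu(\mathfrak m)-d+1$, where $e(R)=\lim_{n\to\infty} d!\,\lambda_R(R/\mathfrak m^n)/n^d$ is the multiplicity of $R$ ($\lambda_R$ denotes length) and $\mu(\mathfrak m)$ is the minimal number of generators of $\mathfrak m$. Suppose that $R$ has a canonical module $\omega$, i.e. a finitely generated $R$-module with $\operatorname{rank}_k \operatorname{Ext}_R^i(k,\omega)=\delta_{id}$ for all $i\ge 0$. For $n\ge 0$ let $\Omega_n^R(k)$ be the $n$th syzygy module of $k$, i.e. the image of the $n$th differential of an augmented minimal free resolution of $k$ (so $\Omega_0^R(k)=k$). Let $L$ be a non-zero maximal Cohen-Macaulay $R$-module (finitely generated, with $\operatorname{depth} L=\dim L=d$) that is a homomorphic image of a finite direct sum of modules $\Omega_n^R(k)$, $n\ge 0$ (repetitions allowed). Then the following statements are equivalent: (i) $\operatorname{Ext}_R^i(\omega,L)=0$ for some $d+1$ consecutive values of $i\ge 1$; (ii) $\operatorname{Ext}_R^i(\omega,L)=0$ for all $i\ge 1$;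 (iii) $R$ is Gorenstein, i.e. $R$ has finite injective dimension as an $R$-module; (iv) $\operatorname{Tor}^R_i(\omega,L)=0$ for some $d+1$ consecutive values of $i\ge 1$; (v) $\operatorname{Tor}^R_i(\omega,L)=0$ for all $i\ge 1$. -/

import Mathlib

open CategoryTheory IsLocalRing

universe u

namespace CMLocal

section Depth

variable (R : Type u) [CommRing R] [IsLocalRing R]

/-- The depth of a module `M` over a local ring `R`: the supremum of the lengths of the
`M`-regular sequences contained in the maximal ideal. -/
noncomputable def depth (M : Type u) [AddCommGroup M] [Module R M] : ℕ∞ :=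
  ⨆ rs : {rs : List R // (∀ r ∈ rs, r ∈ maximalIdeal R) ∧ RingTheory.Sequence.IsRegular M rs},
    (rs.1.length : ℕ∞)

/-- A (non-zero) finitely generated module `M` is Cohen-Macaulay if `depth M = dim M`. -/
structure IsCohenMacaulayModule (M : Type u) [AddCommGroup M] [Module R M] : Prop where
  finite : Module.Finite R M
  depth_eq : (depth R M : WithBot ℕ∞) = Module.supportDim R M

/-- A (non-zero) module `M` is maximal Cohen-Macaulay if it is Cohen-Macaulay and
`dim M = dim R`. -/
structure IsMCM (M : Type u) [AddCommGroup M] [Module R M] : Prop where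
  isCohenMacaulayModule : IsCohenMacaulayModule R M
  dim_eq : Module.supportDim R M = ringKrullDim R

/-- A local ring is Cohen-Macaulay if it is so as a module over itself. -/
def IsCohenMacaulayRing : Prop := IsCohenMacaulayModule R R

end Depth

section Multiplicity

variable (R : Type u) [CommRing R] [IsLocalRing R]

/-- `e(R) = e`: the Hilbert-Samuel multiplicity
`lim_{n → ∞} d! · length (R / 𝔪 ^ n) / n ^ d`, where `d = dim R`, exists and is `e`.
(Over a Noetherian local ring the limit always exists and the lengths are finite.) -/
def HasMultiplicity (e : ℝ) : Prop :=
  ∃ d : ℕ, ringKrullDim R = d ∧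
    Filter.Tendsto
      (fun n : ℕ => (d.factorial : ℝ) *
        ((Module.length R (R ⧸ maximalIdeal R ^ n)).toNat : ℝ) / (n : ℝ) ^ d)
      Filter.atTop (nhds e)

/-- `R` has minimal multiplicity: `e(R) = μ(𝔪) - dim R + 1`, with `μ(𝔪)` the minimal number of
generators of the maximal ideal. -/
def HasMinimalMultiplicity : Prop :=
  ∃ d : ℕ, ringKrullDim R = d ∧
    HasMultiplicity R (((maximalIdeal R).spanFinrank : ℝ) - (d : ℝ) + 1)

end Multiplicity

section Syzygy

variable (R : Type u) [CommRing R] [IsLocalRing R]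

/-- An augmented minimal free resolution
`⋯ → F₂ → F₁ → F₀ → M → 0`, with `Fₙ = R ^ (rank n)`: the augmentation `ε` is surjective, the
sequence is exact, and each differential `d n : Fₙ₊₁ → Fₙ` has image in `𝔪 Fₙ`. -/
structure MinimalFreeResolution (M : Type u) [AddCommGroup M] [Module R M] where
  rank : ℕ → ℕ
  ε : (Fin (rank 0) → R) →ₗ[R] M
  d : ∀ n : ℕ, (Fin (rank (n + 1)) → R) →ₗ[R] (Fin (rank n) → R)
  ε_surjective : Function.Surjective ε
  exact_ε : Function.Exact (d 0) ε
  exact_d : ∀ n : ℕ, Function.Exact (d (n + 1)) (d n)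
  minimal : ∀ n : ℕ,
    LinearMap.range (d n) ≤ maximalIdeal R • (⊤ : Submodule R (Fin (rank n) → R))

variable {R}

/-- The `n`th syzygy module: the image of the `n`th differential of the augmented resolution,
the `0`th differential being the augmentation (so that the `0`th syzygy module is `M`). -/
noncomputable def MinimalFreeResolution.syzygy {M : Type u} [AddCommGroup M] [Module R M]
    (P : MinimalFreeResolution R M) : ℕ → ModuleCat.{u} R
  | 0 => ModuleCat.of R (LinearMap.range P.ε)
  | n + 1 => ModuleCat.of R (LinearMap.range (P.d n))

variable (R)

/-- `L` is a homomorphic image of a finite direct sum of syzygy modules of the residue field.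
(Minimal free resolutions exist and are unique up to isomorphism, so that the choice of `P` is
immaterial.) -/
def IsImageOfResidueFieldSyzygies (L : Type u) [AddCommGroup L] [Module R L] : Prop :=
  ∃ (P : MinimalFreeResolution R (ResidueField R)) (r : ℕ) (n : Fin r → ℕ)
    (f : ((j : Fin r) → P.syzygy (n j)) →ₗ[R] L), Function.Surjective f

end Syzygy

section Homological

variable (R : Type u) [CommRing R]

/-- The `R`-module `Ext_R^i(M, N)`. -/
noncomputable abbrev ExtModule (M N : Type u) [AddCommGroup M] [Module R M]
    [AddCommGroup N] [Module R N] (i : ℕ) : Type u :=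
  Abelian.Ext.{u} (ModuleCat.of R M) (ModuleCat.of R N) i

/-- The `R`-module `Tor_i^R(M, N)`. -/
noncomputable abbrev TorModule (M N : Type u) [AddCommGroup M] [Module R M]
    [AddCommGroup N] [Module R N] (i : ℕ) : ModuleCat.{u} R :=
  ((Tor (ModuleCat.{u} R) i).obj (ModuleCat.of R M)).obj (ModuleCat.of R N)

/-- A (Noetherian local) ring is Gorenstein if it has finite injective dimension as a module over
itself. -/
def IsGorenstein : Prop :=
  ∃ n : ℕ, HasInjectiveDimensionLE (ModuleCat.of R R) n

/-- A finitely generated module `ω` is a canonical module of `R` if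
`rank_k Ext_R^i(k, ω) = δ_{i d}` for all `i ≥ 0`, where `d = dim R`. Since `Ext_R^i(k, ω)` is
annihilated by the maximal ideal, its rank over `k` is its length over `R`. -/
structure IsCanonicalModule [IsLocalRing R] (ω : Type u) [AddCommGroup ω] [Module R ω] :
    Prop where
  finite : Module.Finite R ω
  length_ext : ∀ i : ℕ, Module.length R (ExtModule R (ResidueField R) ω i) =
    if (i : WithBot ℕ∞) = ringKrullDim R then 1 else 0

end Homological

end CMLocal

/-! Vanishing of `Ext` or `Tor` in d + 1 consecutive degrees makes a term of the minimal free
resolution P of ω zero; then ω is free and R is Gorenstein. Conversely, over a Gorenstein ring ω is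
free.

The first step rests on one property of L. After a flat local extension S with 𝔪S = 𝔫 and infinite
residue field, some sequence x of d elements, regular on S and on S ⊗ L, satisfies 𝔫(S ⊗ L) = x(S ⊗
L). Choose x superficial. Comparing Hilbert functions gives length(S/x) ≤ e(R), while d elements of
𝔫 lower length(S/𝔫²) = μ(𝔪) + 1 by at most d; so minimal multiplicity yields 𝔫² ⊆ (x)
(`IsSuperficialSequence.maximalIdeal_sq_le`). Moreover each element of x lies outside 𝔫² plus its
predecessors, so in the resolution F of the residue field the cycles with entries in 𝔫 remain
boundaries modulo x (`MinimalCyclesAreBoundaries.sup_span`). By minimality the differential sends 𝔫F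
into 𝔫²F, which is zero modulo x. So all of 𝔫F consists of boundaries modulo x: modulo x, 𝔫 kills
the syzygies of the residue field and their images, such as L.

Now Hom(P, L) or P ⊗ L, base changed to S, is exact at d + 1 consecutive spots. Each regular element
factored out costs one spot; one remains at the end, with coefficients in a nonzero module killed by
𝔫. The matrices of P have entries in 𝔫, so both maps there are zero and the rank at that spot is
zero (`eq_zero_of_exact_cochain`, `eq_zero_of_exact_chain`).

Thus ω has finite projective dimension, and Ext^i(k, ω) = 0 for i < d = depth R, so ω is free. Then
R is a direct summand of ω and inherits the vanishing of Ext^i(k, -) for i > d, which gives finite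
injective dimension. Conversely, if R is Gorenstein, all syzygies of ω have injective dimension at
most d, so 0 → Ω_{d+1} → F_d → Ω_d → 0 (now for F = P) splits, and minimality forces Ω_{d+1} = 0. -/

namespace CMLocal

/-! ### Elementary vanishing of `Ext`: exact sequences, retracts, finite powers -/

section ExtSequences

variable {R : Type u} [CommRing R] {A B C : Type u} [AddCommGroup A] [AddCommGroup B]
  [AddCommGroup C] [Module R A] [Module R B] [Module R C] {f : A →ₗ[R] B} {g : B →ₗ[R] C}

/-- The short exact sequence in `ModuleCat R` attached to a short exact sequence of modules. -/
theorem shortExact_of_exact (hf : Function.Injective f) (hfg : Function.Exact f g)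
    (hg : Function.Surjective g) :
    (ModuleCat.shortComplexOfCompEqZero f g hfg.linearMap_comp_eq_zero).ShortExact :=
  ModuleCat.shortComplex_shortExact _ hfg hf hg

variable (hf : Function.Injective f) (hfg : Function.Exact f g) (hg : Function.Surjective g)
  (X : Type u) [AddCommGroup X] [Module R X]

include hf hfg hg

theorem subsingleton_ext_left_of_covariant {n : ℕ} (hC : Subsingleton (ExtModule R X C n))
    (hB : Subsingleton (ExtModule R X B (n + 1))) : Subsingleton (ExtModule R X A (n + 1)) := by
  refine subsingleton_of_forall_eq 0 fun x ↦ ?_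
  obtain ⟨y, rfl⟩ := Abelian.Ext.covariant_sequence_exact₁ _ (shortExact_of_exact hf hfg hg) x
    (Subsingleton.elim (α := ExtModule R X B (n + 1)) _ _) rfl
  rw [Subsingleton.elim (α := ExtModule R X C n) y 0, Abelian.Ext.zero_comp]

theorem subsingleton_ext_right_of_covariant {n : ℕ} (hB : Subsingleton (ExtModule R X B n))
    (hA : Subsingleton (ExtModule R X A (n + 1))) : Subsingleton (ExtModule R X C n) := by
  refine subsingleton_of_forall_eq 0 fun x ↦ ?_
  obtain ⟨y, rfl⟩ := Abelian.Ext.covariant_sequence_exact₃ _ (shortExact_of_exact hf hfg hg) x rfl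
    (Subsingleton.elim (α := ExtModule R X A (n + 1)) _ _)
  rw [Subsingleton.elim (α := ExtModule R X B n) y 0, Abelian.Ext.zero_comp]

theorem subsingleton_ext_left_of_contravariant {n : ℕ} (hB : Subsingleton (ExtModule R B X n))
    (hC : Subsingleton (ExtModule R C X (n + 1))) : Subsingleton (ExtModule R A X n) := by
  refine subsingleton_of_forall_eq 0 fun x ↦ ?_
  obtain ⟨y, rfl⟩ := Abelian.Ext.contravariant_sequence_exact₁ (shortExact_of_exact hf hfg hg) _ x
    (add_comm 1 n) (Subsingleton.elim (α := ExtModule R C X (n + 1)) _ _)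
  rw [Subsingleton.elim (α := ExtModule R B X n) y 0, Abelian.Ext.comp_zero]

theorem subsingleton_ext_middle_of_contravariant {n : ℕ} (hA : Subsingleton (ExtModule R A X n))
    (hC : Subsingleton (ExtModule R C X n)) : Subsingleton (ExtModule R B X n) := by
  refine subsingleton_of_forall_eq 0 fun x ↦ ?_
  obtain ⟨y, rfl⟩ := Abelian.Ext.contravariant_sequence_exact₂ (shortExact_of_exact hf hfg hg) _ x
    (Subsingleton.elim (α := ExtModule R A X n) _ _)
  rw [Subsingleton.elim (α := ExtModule R C X n) y 0, Abelian.Ext.comp_zero]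

end ExtSequences

section ExtBasic

variable {R : Type u} [CommRing R] {A B X : Type u} [AddCommGroup A] [AddCommGroup B]
  [AddCommGroup X] [Module R A] [Module R B] [Module R X]

theorem subsingleton_ext_zero_iff : Subsingleton (ExtModule R A B 0) ↔ Subsingleton (A →ₗ[R] B) :=
  (Abelian.Ext.addEquiv₀.trans ModuleCat.homAddEquiv).toEquiv.subsingleton_congr

theorem subsingleton_ext_of_subsingleton_left [Subsingleton A] (n : ℕ) :
    Subsingleton (ExtModule R A B n) := by
  refine subsingleton_of_forall_eq 0 fun x ↦ ?_
  rw [← x.mk₀_id_comp, (ModuleCat.isZero_of_subsingleton (ModuleCat.of R A)).eq_of_src (𝟙 _) 0,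
    Abelian.Ext.mk₀_zero, Abelian.Ext.zero_comp]

theorem subsingleton_ext_of_retract (s : A →ₗ[R] B) (r : B →ₗ[R] A) (h : r ∘ₗ s = LinearMap.id)
    {n : ℕ} (hB : Subsingleton (ExtModule R X B n)) : Subsingleton (ExtModule R X A n) := by
  refine subsingleton_of_forall_eq 0 fun x ↦ ?_
  have h' : ModuleCat.ofHom s ≫ ModuleCat.ofHom r = 𝟙 _ := by
    rw [← ModuleCat.ofHom_comp, h, ModuleCat.ofHom_id]
  rw [← x.comp_mk₀_id, ← h', ← Abelian.Ext.mk₀_comp_mk₀,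
    ← Abelian.Ext.comp_assoc_of_second_deg_zero,
    Subsingleton.elim (α := ExtModule R X B n) (x.comp _ (add_zero n)) 0, Abelian.Ext.zero_comp]

theorem subsingleton_ext_congr_right (e : A ≃ₗ[R] B) {n : ℕ} :
    Subsingleton (ExtModule R X A n) ↔ Subsingleton (ExtModule R X B n) :=
  ⟨subsingleton_ext_of_retract (e.symm : B →ₗ[R] A) (e : A →ₗ[R] B) (by ext; simp),
    subsingleton_ext_of_retract (e : A →ₗ[R] B) (e.symm : B →ₗ[R] A) (by ext; simp)⟩

theorem subsingleton_ext_of_retract_left (s : A →ₗ[R] B) (r : B →ₗ[R] A)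
    (h : r ∘ₗ s = LinearMap.id)
    {n : ℕ} (hB : Subsingleton (ExtModule R B X n)) : Subsingleton (ExtModule R A X n) := by
  refine subsingleton_of_forall_eq 0 fun x ↦ ?_
  have h' : ModuleCat.ofHom s ≫ ModuleCat.ofHom r = 𝟙 _ := by
    rw [← ModuleCat.ofHom_comp, h, ModuleCat.ofHom_id]
  rw [← x.mk₀_id_comp, ← h', ← Abelian.Ext.mk₀_comp_mk₀,
    Abelian.Ext.comp_assoc_of_second_deg_zero,
    Subsingleton.elim (α := ExtModule R B X n) (Abelian.Ext.comp _ x (zero_add n)) 0,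
    Abelian.Ext.comp_zero]

theorem subsingleton_ext_congr_left (e : A ≃ₗ[R] B) {n : ℕ} :
    Subsingleton (ExtModule R A X n) ↔ Subsingleton (ExtModule R B X n) :=
  ⟨subsingleton_ext_of_retract_left (e.symm : B →ₗ[R] A) (e : A →ₗ[R] B) (by ext; simp),
    subsingleton_ext_of_retract_left (e : A →ₗ[R] B) (e.symm : B →ₗ[R] A) (by ext; simp)⟩

theorem subsingleton_ext_of_projective [Module.Projective R A] (n : ℕ) :
    Subsingleton (ExtModule R A B (n + 1)) := by
  have : Projective (ModuleCat.of R A) := (IsProjective.iff_projective A).mp inferInstance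
  exact Abelian.Ext.subsingleton_of_projective _ _ _

theorem subsingleton_ext_pi {ι : Type} [Finite ι] {n : ℕ} (h : Subsingleton (ExtModule R X A n)) :
    Subsingleton (ExtModule R X (ι → A) n) := by
  classical
  have := Fintype.ofFinite ι
  refine subsingleton_of_forall_eq 0 fun x ↦ ?_
  have hid : 𝟙 (ModuleCat.of R (ι → A)) = ∑ i : ι, ModuleCat.ofHom (LinearMap.proj i) ≫
      ModuleCat.ofHom (LinearMap.single R (fun _ ↦ A) i) := by
    ext v j
    simp [ModuleCat.hom_sum, Finset.sum_apply, Pi.single_apply]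
  rw [← x.comp_mk₀_id, hid, Abelian.Ext.mk₀_sum, Abelian.Ext.comp_sum]
  refine Finset.sum_eq_zero fun i _ ↦ ?_
  rw [← Abelian.Ext.mk₀_comp_mk₀, ← Abelian.Ext.comp_assoc_of_second_deg_zero,
    Subsingleton.elim (α := ExtModule R X A n) (x.comp _ (add_zero n)) 0, Abelian.Ext.zero_comp]

theorem smul_ext_eq_zero {r : R} (hr : ∀ a : A, r • a = 0) {n : ℕ} (x : ExtModule R A B n) :
    r • x = 0 := by
  have : r • 𝟙 (ModuleCat.of R A) = 0 := by ext a; exact hr a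
  rw [← x.mk₀_id_comp, ← Abelian.Ext.smul_comp, ← Abelian.Ext.mk₀_smul, this,
    Abelian.Ext.mk₀_zero, Abelian.Ext.zero_comp]

end ExtBasic

/-! ### Injective dimension tested on the residue field -/

section InjectiveDimension

variable {R : Type u} [CommRing R]

/-- Baer's criterion in degree one, then dimension shifting along an embedding into an injective
module. -/
theorem hasInjectiveDimensionLT_of_subsingleton_ext_quotient (n : ℕ) (K : Type u) [AddCommGroup K]
    [Module R K] (h : ∀ I : Ideal R, Subsingleton (ExtModule R (R ⧸ I) K (n + 1))) :
    HasInjectiveDimensionLT (ModuleCat.of R K) (n + 1) := by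
  induction n generalizing K with
  | zero =>
    rw [zero_add, ← injective_iff_hasInjectiveDimensionLT_one,
      ← Module.injective_iff_injective_object, ← Module.Baer.iff_injective]
    intro I φ
    obtain ⟨y, hy⟩ := Abelian.Ext.contravariant_sequence_exact₁
      (shortExact_of_exact I.injective_subtype (LinearMap.exact_subtype_mkQ I)
        (Submodule.mkQ_surjective I)) (ModuleCat.of R K) (Abelian.Ext.mk₀ (ModuleCat.ofHom φ))
      (add_zero 1) (@Subsingleton.elim _ (h I) _ _)
    obtain ⟨ψ, rfl⟩ := Abelian.Ext.homEquiv₀.symm.surjective y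
    have : ModuleCat.ofHom I.subtype ≫ ψ = ModuleCat.ofHom φ :=
      Abelian.Ext.homEquiv₀.symm.injective (by simpa using hy)
    refine ⟨ψ.hom, fun x hx ↦ ?_⟩
    exact congr($(this).hom ⟨x, hx⟩)
  | succ n ih =>
    obtain ⟨E, hE, f, hf⟩ := EnoughInjectives.presentation (ModuleCat.of R K)
    have hinj : Function.Injective f.hom := (ModuleCat.mono_iff_injective f).mp hf
    have hex : Function.Exact f.hom f.hom.range.mkQ := f.hom.exact_map_mkQ_range
    have hS := shortExact_of_exact hinj hex (Submodule.mkQ_surjective _)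
    refine (hS.hasInjectiveDimensionLT_X₃_iff n hE).mp (ih _ fun I ↦ ?_)
    refine subsingleton_ext_right_of_covariant hinj hex (Submodule.mkQ_surjective _) _ ?_ (h I)
    exact HasInjectiveDimensionLT.subsingleton E 1 _ (by omega) _

theorem exact_mulQuotient_colon (I : Ideal R) (a : R) :
    ∃ f : (R ⧸ I.colon {a}) →ₗ[R] R ⧸ I, ∃ g : (R ⧸ I) →ₗ[R] R ⧸ (I ⊔ Ideal.span {a}),
      Function.Injective f ∧ Function.Exact f g ∧ Function.Surjective g := by
  have hmem (x : R) : x ∈ I.colon {a} ↔ x * a ∈ I := by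
    simp [Submodule.mem_colon_singleton]
  have hle : I.colon {a} ≤ Submodule.comap (LinearMap.mulRight R a) I := fun x hx ↦ (hmem x).mp hx
  refine ⟨Submodule.mapQ _ _ (LinearMap.mulRight R a) hle,
    Submodule.factor le_sup_left, ?_, ?_, Submodule.factor_surjective _⟩
  · rw [← LinearMap.ker_eq_bot, LinearMap.ker_eq_bot']
    intro x hx
    obtain ⟨x, rfl⟩ := Submodule.Quotient.mk_surjective _ x
    rw [Submodule.mapQ_apply, Submodule.Quotient.mk_eq_zero] at hx
    rw [Submodule.Quotient.mk_eq_zero, hmem]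
    exact hx
  · intro x
    obtain ⟨x, rfl⟩ := Submodule.Quotient.mk_surjective _ x
    change Submodule.Quotient.mk x = 0 ↔ _
    rw [Submodule.Quotient.mk_eq_zero]
    constructor
    · intro hx
      obtain ⟨i, hi, j, hj, rfl⟩ := Submodule.mem_sup.mp hx
      obtain ⟨c, rfl⟩ := Ideal.mem_span_singleton'.mp hj
      refine ⟨Submodule.Quotient.mk c, ?_⟩
      rw [Submodule.mapQ_apply, Submodule.Quotient.eq]
      simpa using hi
    · rintro ⟨y, hy⟩
      obtain ⟨y, rfl⟩ := Submodule.Quotient.mk_surjective _ y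
      rw [Submodule.mapQ_apply, Submodule.Quotient.eq] at hy
      have h1 : y * a ∈ I ⊔ Ideal.span {a} :=
        Ideal.mem_sup_right (Ideal.mul_mem_left _ _ (Ideal.mem_span_singleton_self a))
      have h2 := Ideal.sub_mem _ h1 (Ideal.mem_sup_left (T := Ideal.span {a}) hy)
      simpa using h2

variable [IsLocalRing R] [IsNoetherianRing R]

/-- Nakayama: `Ext` between finitely generated modules over a Noetherian ring is finitely generated.
-/
theorem subsingleton_ext_of_smul_surjective {A B : Type u} [AddCommGroup A] [AddCommGroup B]
    [Module R A] [Module R B] [Module.Finite R A] [Module.Finite R B] {n : ℕ} {z : R}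
    (hz : z ∈ maximalIdeal R) (h : ∀ x : ExtModule R A B n, ∃ y : ExtModule R A B n, z • y = x) :
    Subsingleton (ExtModule R A B n) := by
  have : (⊤ : Submodule R (ExtModule R A B n)) ≤ maximalIdeal R • ⊤ := by
    intro x _
    obtain ⟨y, rfl⟩ := h x
    exact Submodule.smul_mem_smul hz trivial
  have := Submodule.eq_bot_of_le_smul_of_le_jacobson_bot (maximalIdeal R) _
    (Module.finite_def.mp (ModuleCat.finite_ext R (ModuleCat.of R A) (ModuleCat.of R B) n)) this
    (IsLocalRing.maximalIdeal_le_jacobson _)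
  exact (Submodule.subsingleton_iff R).mp (subsingleton_of_bot_eq_top this.symm)

/-- Vanishing of `Ext` against the residue field from some degree on propagates to all cyclic
modules. -/
theorem subsingleton_ext_quotient_of_residueField {K : Type u} [AddCommGroup K] [Module R K]
    [Module.Finite R K] {t : ℕ}
    (h : ∀ i, t ≤ i → Subsingleton (ExtModule R (ResidueField R) K i)) (I : Ideal R) :
    ∀ i, t ≤ i → Subsingleton (ExtModule R (R ⧸ I) K i) := by
  refine IsNoetherian.induction (P := fun I : Ideal R ↦
    ∀ i, t ≤ i → Subsingleton (ExtModule R (R ⧸ I) K i)) (fun (I : Ideal R) ih ↦ ?_) I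
  · intro i hi
    by_cases htop : I = ⊤
    · subst htop
      exact subsingleton_ext_of_subsingleton_left i
    by_cases hm : I = maximalIdeal R
    · subst hm
      exact h i hi
    by_cases hp : Ideal.IsPrime I
    -- For a prime I ≠ 𝔪, multiplication by z is injective on R/I with cokernel R/(I + z). The
    -- induction hypothesis in degree i + 1 makes z surjective on Ext^i(R/I, K); this shift is why
    -- vanishing is assumed in all degrees from t on.
    · obtain ⟨z, hz, hzI⟩ := SetLike.exists_of_lt (lt_of_le_of_ne (le_maximalIdeal htop) hm)
      let f : (R ⧸ I) →ₗ[R] R ⧸ I := z • LinearMap.id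
      let g : (R ⧸ I) →ₗ[R] R ⧸ (I ⊔ Ideal.span {z}) := Submodule.factor le_sup_left
      have hinj : Function.Injective f := by
        rw [← LinearMap.ker_eq_bot, LinearMap.ker_eq_bot']
        intro x hx
        obtain ⟨x, rfl⟩ := Submodule.Quotient.mk_surjective _ x
        have hx' : Submodule.Quotient.mk (z • x) = (0 : R ⧸ I) := hx
        rw [Submodule.Quotient.mk_eq_zero] at hx' ⊢
        exact (hp.mem_or_mem hx').resolve_left hzI
      have hex : Function.Exact f g := by
        intro x
        obtain ⟨x, rfl⟩ := Submodule.Quotient.mk_surjective _ x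
        change Submodule.Quotient.mk x = 0 ↔ _
        rw [Submodule.Quotient.mk_eq_zero]
        constructor
        · intro hx
          obtain ⟨a, ha, b, hb, rfl⟩ := Submodule.mem_sup.mp hx
          obtain ⟨c, rfl⟩ := Ideal.mem_span_singleton'.mp hb
          refine ⟨Submodule.Quotient.mk c, ?_⟩
          change Submodule.Quotient.mk (z • c) = _
          rw [Submodule.Quotient.eq]
          simpa [mul_comm] using ha
        · rintro ⟨y, hy⟩
          obtain ⟨y, rfl⟩ := Submodule.Quotient.mk_surjective _ y
          have hy' : Submodule.Quotient.mk (z • y) = (Submodule.Quotient.mk x : R ⧸ I) := hy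
          rw [Submodule.Quotient.eq] at hy'
          have h1 : z • y ∈ I ⊔ Ideal.span {z} :=
            Ideal.mem_sup_right (Ideal.mul_mem_right _ _ (Ideal.mem_span_singleton_self z))
          have h2 := Ideal.sub_mem _ h1 (Ideal.mem_sup_left (T := Ideal.span {z}) hy')
          simpa using h2
      have hlt : I < I ⊔ Ideal.span {z} :=
        lt_of_le_of_ne le_sup_left fun he ↦ hzI (he ▸ Ideal.mem_sup_right
          (Ideal.mem_span_singleton_self z))
      refine subsingleton_ext_of_smul_surjective hz fun x ↦ ?_
      obtain ⟨y, hy⟩ := Abelian.Ext.contravariant_sequence_exact₁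
        (shortExact_of_exact hinj hex (Submodule.factor_surjective _)) (ModuleCat.of R K) x
        (add_comm 1 i) (@Subsingleton.elim _ (ih _ hlt (i + 1) (by omega)) _ _)
      refine ⟨y, ?_⟩
      rw [← hy]
      have : ModuleCat.ofHom f = z • 𝟙 (ModuleCat.of R (R ⧸ I)) := rfl
      change _ = Abelian.Ext.comp (Abelian.Ext.mk₀ (ModuleCat.ofHom f)) y _
      rw [this, Abelian.Ext.mk₀_smul, Abelian.Ext.smul_comp, Abelian.Ext.mk₀_id_comp]
    -- If I is not prime, R/I is an extension of R/(I + a) by R/(I : a), and both ideals are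
    -- strictly larger than I.
    · obtain ⟨a, ha, b, hb, hab⟩ : ∃ a, a ∉ I ∧ ∃ b, b ∉ I ∧ b * a ∈ I := by
        rw [Ideal.isPrime_iff] at hp
        push Not at hp
        obtain ⟨a, b, hab, ha, hb⟩ := hp htop
        exact ⟨b, hb, a, ha, hab⟩
      obtain ⟨f, g, hf, hfg, hg⟩ := exact_mulQuotient_colon I a
      refine subsingleton_ext_middle_of_contravariant hf hfg hg _ (ih _ ?_ i hi) (ih _ ?_ i hi)
      · refine lt_of_le_of_ne (fun x hx ↦ ?_) fun he ↦ hb ?_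
        · simpa [Submodule.mem_colon_singleton] using Ideal.mul_mem_right a _ hx
        · rw [he]
          simpa [Submodule.mem_colon_singleton] using hab
      · exact lt_of_le_of_ne le_sup_left fun he ↦ ha (he ▸ Ideal.mem_sup_right
          (Ideal.mem_span_singleton_self a))

theorem hasInjectiveDimensionLT_of_subsingleton_ext_residueField {K : Type u} [AddCommGroup K]
    [Module R K] [Module.Finite R K] {t : ℕ}
    (h : ∀ i, t + 1 ≤ i → Subsingleton (ExtModule R (ResidueField R) K i)) :
    HasInjectiveDimensionLT (ModuleCat.of R K) (t + 1) :=
  hasInjectiveDimensionLT_of_subsingleton_ext_quotient t K fun I ↦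
    subsingleton_ext_quotient_of_residueField h I _ le_rfl

end InjectiveDimension

/-! ### Depth through `Ext` from the residue field -/

section Depth

variable {R : Type u} [CommRing R] [IsLocalRing R] [IsNoetherianRing R]
  {M : Type u} [AddCommGroup M] [Module R M] [Module.Finite R M]

omit [IsNoetherianRing R] in
theorem support_residueField :
    Module.support R (ResidueField R) = PrimeSpectrum.zeroLocus (maximalIdeal R) := by
  change Module.support R (R ⧸ maximalIdeal R) = _
  rw [Module.support_eq_zeroLocus, Ideal.annihilator_quotient]

omit [IsNoetherianRing R] in
theorem maximalIdeal_smul_top_lt [Nontrivial M] :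
    maximalIdeal R • (⊤ : Submodule R M) < ⊤ := by
  refine lt_top_iff_ne_top.mpr fun h ↦ ?_
  have := Submodule.eq_bot_of_le_smul_of_le_jacobson_bot (maximalIdeal R) (⊤ : Submodule R M)
    Module.Finite.fg_top h.ge (IsLocalRing.maximalIdeal_le_jacobson _)
  exact top_ne_bot this

theorem subsingleton_ext_of_isRegular {rs : List R} (hrs : ∀ r ∈ rs, r ∈ maximalIdeal R)
    (hreg : RingTheory.Sequence.IsRegular M rs) {i : ℕ} (hi : i < rs.length) :
    Subsingleton (ExtModule R (ResidueField R) M i) := by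
  have : Nontrivial M := hreg.nontrivial
  have : Module.Finite R (ResidueField R) := inferInstanceAs (Module.Finite R (R ⧸ maximalIdeal R))
  exact ModuleCat.subsingleton_ext_of_exists_isRegular (maximalIdeal R)
    (ModuleCat.of R (ResidueField R)) support_residueField.subset (ModuleCat.of R M)
    maximalIdeal_smul_top_lt rs hrs hreg i hi

theorem exists_isRegular_of_subsingleton_ext [Nontrivial M] {n : ℕ}
    (h : ∀ i < n, Subsingleton (ExtModule R (ResidueField R) M i)) :
    ∃ rs : List R, rs.length = n ∧ (∀ r ∈ rs, r ∈ maximalIdeal R) ∧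
      RingTheory.Sequence.IsRegular M rs := by
  have : Module.Finite R (ResidueField R) := inferInstanceAs (Module.Finite R (R ⧸ maximalIdeal R))
  exact ModuleCat.exists_isRegular_of_exists_subsingleton_ext (maximalIdeal R) n
    (ModuleCat.of R M) maximalIdeal_smul_top_lt (ModuleCat.of R (ResidueField R))
    support_residueField h

omit [IsNoetherianRing R] [Module.Finite R M] in
theorem length_le_depth {rs : List R} (hrs : ∀ r ∈ rs, r ∈ maximalIdeal R)
    (hreg : RingTheory.Sequence.IsRegular M rs) : (rs.length : ℕ∞) ≤ depth R M :=
  le_iSup (fun rs : {rs : List R // (∀ r ∈ rs, r ∈ maximalIdeal R) ∧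
    RingTheory.Sequence.IsRegular M rs} ↦ (rs.1.length : ℕ∞)) ⟨rs, hrs, hreg⟩

omit [IsNoetherianRing R] [Module.Finite R M] in
theorem exists_isRegular_of_depth_eq {d : ℕ} [Nontrivial M] (h : depth R M = d) :
    ∃ rs : List R, rs.length = d ∧ (∀ r ∈ rs, r ∈ maximalIdeal R) ∧
      RingTheory.Sequence.IsRegular M rs := by
  have : Nonempty {rs : List R // (∀ r ∈ rs, r ∈ maximalIdeal R) ∧
    RingTheory.Sequence.IsRegular M rs} := ⟨[], by simp, RingTheory.Sequence.IsRegular.nil R M⟩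
  obtain ⟨⟨rs, h1, h2⟩, h3⟩ := ENat.exists_eq_iSup_of_lt_top
    (f := fun rs : {rs : List R // (∀ r ∈ rs, r ∈ maximalIdeal R) ∧
      RingTheory.Sequence.IsRegular M rs} ↦ (rs.1.length : ℕ∞))
    (h.trans_lt (ENat.natCast_lt_top d))
  exact ⟨rs, by exact_mod_cast h3.trans h, h1, h2⟩

theorem subsingleton_ext_of_depth_eq {d : ℕ} [Nontrivial M] (h : depth R M = d) {i : ℕ}
    (hi : i < d) : Subsingleton (ExtModule R (ResidueField R) M i) := by
  obtain ⟨rs, rfl, h1, h2⟩ := exists_isRegular_of_depth_eq h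
  exact subsingleton_ext_of_isRegular h1 h2 hi

/-- Otherwise there would be a regular sequence longer than the depth. -/
theorem not_subsingleton_ext_of_depth_eq {d : ℕ} [Nontrivial M] (h : depth R M = d) :
    ¬ Subsingleton (ExtModule R (ResidueField R) M d) := by
  intro hd
  obtain ⟨rs, h0, h1, h2⟩ := exists_isRegular_of_subsingleton_ext (R := R) (M := M) (n := d + 1)
    fun i hi ↦ (Nat.lt_succ_iff_lt_or_eq.mp hi).elim (subsingleton_ext_of_depth_eq h) (· ▸ hd)
  have := length_le_depth h1 h2
  rw [h0, h] at this
  exact absurd (by exact_mod_cast this) (Nat.lt_succ_self d).not_ge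

end Depth

section Extension

variable {R : Type u} [CommRing R] {A B C X : Type u} [AddCommGroup A] [AddCommGroup B]
  [AddCommGroup C] [AddCommGroup X] [Module R A] [Module R B] [Module R C] [Module R X]
  {f : A →ₗ[R] B} {g : B →ₗ[R] C}

theorem exists_extension_of_subsingleton_ext_one (hf : Function.Injective f)
    (hfg : Function.Exact f g) (hg : Function.Surjective g)
    (h : Subsingleton (ExtModule R C X 1)) (φ : A →ₗ[R] X) : ∃ ψ : B →ₗ[R] X, ψ ∘ₗ f = φ := by
  obtain ⟨y, hy⟩ := Abelian.Ext.contravariant_sequence_exact₁ (shortExact_of_exact hf hfg hg)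
    (ModuleCat.of R X) (Abelian.Ext.mk₀ (ModuleCat.ofHom φ)) (add_zero 1)
    (@Subsingleton.elim _ h _ _)
  obtain ⟨ψ, rfl⟩ := Abelian.Ext.homEquiv₀.symm.surjective y
  have : ModuleCat.ofHom f ≫ ψ = ModuleCat.ofHom φ :=
    Abelian.Ext.homEquiv₀.symm.injective (by simpa using hy)
  exact ⟨ψ.hom, congr($(this).hom)⟩

theorem subsingleton_ext_zero_of_injective (hf : Function.Injective f)
    (h : Subsingleton (ExtModule R X B 0)) : Subsingleton (ExtModule R X A 0) := by
  rw [subsingleton_ext_zero_iff] at h ⊢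
  refine subsingleton_of_forall_eq 0 fun φ ↦ LinearMap.ext fun x ↦ hf ?_
  simpa using congr($(Subsingleton.elim (f ∘ₗ φ) 0) x)

end Extension

/-! ### Minimal free resolutions and their syzygies -/

section MinimalCover

variable {R : Type u} [CommRing R] [IsLocalRing R]

omit [IsLocalRing R] in
theorem mem_smul_top_pi_iff {ι : Type} [Finite ι] {I : Ideal R} {v : ι → R} :
    v ∈ I • (⊤ : Submodule R (ι → R)) ↔ ∀ i, v i ∈ I := by
  classical
  have := Fintype.ofFinite ι
  constructor
  · intro h i
    have : I • (⊤ : Submodule R (ι → R)) ≤ Submodule.comap (LinearMap.proj i) I :=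
      Submodule.smul_le.mpr fun r hr n _ ↦ I.mul_mem_right _ hr
    exact this h
  · intro h
    rw [pi_eq_sum_univ v]
    exact Submodule.sum_mem _ fun i _ ↦ Submodule.smul_mem_smul (h i) trivial

/-- When the number of generators is least, no relation has a unit coefficient, since it would
express one generator by the others. -/
theorem exists_minimal_cover (M : Type u) [AddCommGroup M] [Module R M] [Module.Finite R M] :
    ∃ (n : ℕ) (f : (Fin n → R) →ₗ[R] M), Function.Surjective f ∧
      LinearMap.ker f ≤ maximalIdeal R • ⊤ := by
  classical
  have hex : ∃ n, ∃ f : (Fin n → R) →ₗ[R] M, Function.Surjective f := Module.Finite.exists_fin' R M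
  obtain ⟨f, hf⟩ := Nat.find_spec hex
  refine ⟨Nat.find hex, f, hf, fun v hv ↦ mem_smul_top_pi_iff.mpr fun i ↦ ?_⟩
  by_contra hi
  obtain ⟨k, hk⟩ : ∃ k, Nat.find hex = k + 1 := Nat.exists_eq_succ_of_ne_zero i.pos.ne'
  have hmin := Nat.find_min hex (m := k) (by omega)
  generalize Nat.find hex = n at f hf v hv i hi hk
  subst hk
  obtain ⟨w, hw⟩ := (notMem_maximalIdeal.mp hi).exists_right_inv
  refine hmin ⟨f ∘ₗ LinearMap.pi fun j ↦ if h : ∃ l, i.succAbove l = j then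
    LinearMap.proj h.choose else 0, fun y ↦ ?_⟩
  obtain ⟨u, rfl⟩ := hf y
  -- Subtracting this multiple of the relation v leaves the image unchanged and kills the i-th
  -- coordinate, so the remaining coordinates suffice.
  refine ⟨fun l ↦ (u - (u i * w) • v) (i.succAbove l), ?_⟩
  have h1 : f u = f (u - (u i * w) • v) := by
    rw [map_sub, map_smul, LinearMap.mem_ker.mp hv, smul_zero, sub_zero]
  rw [h1, LinearMap.comp_apply]
  congr 1
  ext j
  rw [LinearMap.pi_apply]
  split_ifs with h
  · rw [LinearMap.proj_apply, h.choose_spec]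
  · have hj : j = i := by
      by_contra hj
      exact h (Fin.exists_succAbove_eq hj)
    subst hj
    simp only [LinearMap.zero_apply, Pi.sub_apply, Pi.smul_apply, smul_eq_mul]
    linear_combination (u j) * hw

variable [IsNoetherianRing R]

/-- One step of the recursion that builds the resolution. Packing the rank with the submodule gives
the recursion a fixed type. -/
theorem exists_minimal_cover_kernel (s : Σ n : ℕ, Submodule R (Fin n → R)) :
    ∃ (t : Σ n : ℕ, Submodule R (Fin n → R)) (f : (Fin t.1 → R) →ₗ[R] (Fin s.1 → R)),
      LinearMap.range f = s.2 ∧ LinearMap.ker f = t.2 ∧ t.2 ≤ maximalIdeal R • ⊤ := by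
  obtain ⟨n, f, hf, hmin⟩ := exists_minimal_cover (R := R) s.2
  refine ⟨⟨n, LinearMap.ker f⟩, s.2.subtype ∘ₗ f, ?_, ?_, hmin⟩
  · rw [LinearMap.range_comp, LinearMap.range_eq_top.mpr hf, Submodule.map_top,
      Submodule.range_subtype]
  · exact LinearMap.ker_comp_of_ker_eq_bot _ s.2.ker_subtype

theorem nonempty_minimalFreeResolution (M : Type u) [AddCommGroup M] [Module R M]
    [Module.Finite R M] : Nonempty (MinimalFreeResolution R M) := by
  obtain ⟨n, f, hf, hmin⟩ := exists_minimal_cover (R := R) M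
  choose t φ hrange hker hle using exists_minimal_cover_kernel (R := R)
  let s : ℕ → Σ n : ℕ, Submodule R (Fin n → R) := Nat.rec ⟨n, LinearMap.ker f⟩ fun _ s ↦ t s
  refine ⟨{
    rank := fun i ↦ (s i).1
    ε := f
    d := fun i ↦ φ (s i)
    ε_surjective := hf
    exact_ε := LinearMap.exact_iff.mpr (hrange (s 0)).symm
    exact_d := fun i ↦ LinearMap.exact_iff.mpr ((hker (s i)).trans (hrange (s (i + 1))).symm)
    minimal := fun i ↦ ?_ }⟩
  rw [hrange]
  cases i with
  | zero => exact hmin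
  | succ i => exact hle (s i)

end MinimalCover

namespace MinimalFreeResolution

variable {R : Type u} [CommRing R] [IsLocalRing R] {M : Type u} [AddCommGroup M] [Module R M]
  (P : MinimalFreeResolution R M)

/-- The canonical surjection from a term of a free resolution to the corresponding syzygy. -/
noncomputable def cover : ∀ n : ℕ, (Fin (P.rank n) → R) →ₗ[R] P.syzygy n
  | 0 => P.ε.rangeRestrict
  | n + 1 => (P.d n).rangeRestrict

/-- The inclusion of a syzygy in the preceding term of the resolution. -/
noncomputable def inclusion (n : ℕ) : P.syzygy (n + 1) →ₗ[R] (Fin (P.rank n) → R) :=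
  (LinearMap.range (P.d n)).subtype

theorem inclusion_injective (n : ℕ) : Function.Injective (P.inclusion n) :=
  Submodule.injective_subtype _

theorem range_inclusion (n : ℕ) : LinearMap.range (P.inclusion n) = LinearMap.range (P.d n) :=
  Submodule.range_subtype _

theorem cover_surjective : ∀ n : ℕ, Function.Surjective (P.cover n)
  | 0 => P.ε.surjective_rangeRestrict
  | n + 1 => (P.d n).surjective_rangeRestrict

theorem ker_cover : ∀ n : ℕ, LinearMap.ker (P.cover n) = LinearMap.range (P.d n)
  | 0 => P.ε.ker_rangeRestrict.trans (LinearMap.exact_iff.mp P.exact_ε)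
  | n + 1 => (P.d n).ker_rangeRestrict.trans (LinearMap.exact_iff.mp (P.exact_d n))

theorem exact_inclusion_cover (n : ℕ) : Function.Exact (P.inclusion n) (P.cover n) :=
  LinearMap.exact_iff.mpr ((P.ker_cover n).trans (P.range_inclusion n).symm)

theorem inclusion_comp_cover (n : ℕ) : P.inclusion n ∘ₗ P.cover (n + 1) = P.d n := rfl

/-- The zeroth syzygy is the module itself. -/
noncomputable def syzygyZeroEquiv : P.syzygy 0 ≃ₗ[R] M :=
  LinearEquiv.ofTop _ (LinearMap.range_eq_top.mpr P.ε_surjective)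

theorem rank_eq_zero_of_top_le {r : ℕ} (h : (⊤ : Submodule R (Fin r → R)) ≤ maximalIdeal R • ⊤) :
    r = 0 := by
  by_contra hr
  have := mem_smul_top_pi_iff.mp (h (x := fun _ ↦ 1) trivial)
    ⟨0, Nat.pos_of_ne_zero hr⟩
  exact (Ideal.ne_top_iff_one _).mp (maximalIdeal.isMaximal R).ne_top this

theorem rank_succ_eq_zero_of_subsingleton {n : ℕ} [Subsingleton (P.syzygy n)] : P.rank n = 0 := by
  refine rank_eq_zero_of_top_le (le_trans (fun v _ ↦ ?_) (P.minimal n))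
  rw [← P.ker_cover n]
  exact Subsingleton.elim _ _

theorem subsingleton_ext_syzygy_left {X : Type u} [AddCommGroup X] [Module R X] (n i : ℕ)
    (h : Subsingleton (ExtModule R M X (i + 1 + n))) :
    Subsingleton (ExtModule R (P.syzygy n) X (i + 1)) := by
  induction n generalizing i with
  | zero => exact (subsingleton_ext_congr_left P.syzygyZeroEquiv).mpr h
  | succ n ih =>
    refine subsingleton_ext_left_of_contravariant (P.inclusion_injective n)
      (P.exact_inclusion_cover n) (P.cover_surjective n) X (subsingleton_ext_of_projective i)
      (ih (i + 1) ?_)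
    rwa [show i + 1 + 1 + n = i + 1 + (n + 1) by omega]

/-- For X the residue field this is the depth lemma: depth at least d passes from R and M to all
syzygies of M. -/
theorem subsingleton_ext_syzygy_right {X : Type u} [AddCommGroup X] [Module R X] {d : ℕ}
    (hR : ∀ i < d, Subsingleton (ExtModule R X R i))
    (hM : ∀ i < d, Subsingleton (ExtModule R X M i)) (n : ℕ) :
    ∀ i < d, Subsingleton (ExtModule R X (P.syzygy n) i) := by
  induction n with
  | zero => exact fun i hi ↦ (subsingleton_ext_congr_right P.syzygyZeroEquiv).mpr (hM i hi)
  | succ n ih =>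
    rintro (_ | i) hi
    · exact subsingleton_ext_zero_of_injective (P.inclusion_injective n)
        (subsingleton_ext_pi (hR 0 hi))
    · exact subsingleton_ext_left_of_covariant (P.inclusion_injective n)
        (P.exact_inclusion_cover n) (P.cover_surjective n) X (ih i (by omega))
        (subsingleton_ext_pi (hR _ hi))

end MinimalFreeResolution

/-! ### Finite projective dimension and maximal depth force freeness -/

section FiniteProjectiveDimension

variable {R : Type u} [CommRing R] [IsLocalRing R]

/-- A linear map with entries in the maximal ideal acts as zero on `Ext` from the residue field. -/
theorem ext_residueField_comp_eq_zero {m n : ℕ} {f : (Fin m → R) →ₗ[R] (Fin n → R)}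
    (hf : LinearMap.range f ≤ maximalIdeal R • ⊤) {i : ℕ}
    (x : ExtModule R (ResidueField R) (Fin m → R) i) :
    Abelian.Ext.comp x (Abelian.Ext.mk₀ (ModuleCat.ofHom f)) (add_zero i) = 0 := by
  have hsum : ModuleCat.ofHom f = ∑ a : Fin m, ∑ b : Fin n, f (Pi.single a 1) b •
      ModuleCat.ofHom (LinearMap.single R (fun _ ↦ R) b ∘ₗ LinearMap.proj a) := by
    ext a c
    simp [ModuleCat.hom_sum, Finset.sum_apply, Pi.single_apply, Finset.sum_ite_eq]
  rw [hsum, Abelian.Ext.mk₀_sum, Abelian.Ext.comp_sum]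
  refine Finset.sum_eq_zero fun a _ ↦ ?_
  rw [Abelian.Ext.mk₀_sum, Abelian.Ext.comp_sum]
  refine Finset.sum_eq_zero fun b _ ↦ ?_
  rw [Abelian.Ext.mk₀_smul, Abelian.Ext.comp_smul]
  refine smul_ext_eq_zero (A := ResidueField R) (fun y ↦ ?_) _
  obtain ⟨y, rfl⟩ := residue_surjective y
  rw [Algebra.smul_def, ResidueField.algebraMap_eq, ← map_mul, residue_eq_zero_iff]
  exact Ideal.mul_mem_right _ _ (mem_smul_top_pi_iff.mp (hf ⟨_, rfl⟩) b)

variable [IsNoetherianRing R]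

/-- The Auslander–Buchsbaum argument. If F_{n+2} = 0, then 0 → F_{n+1} → F_n → Ω_n → 0 is exact. On
Ext^d(k, -) the first map is zero by minimality, and injective since Ext^{d-1}(k, Ω_n) = 0. So
Ext^d(k, F_{n+1}) = 0, whereas Ext^d(k, R) ≠ 0. -/
theorem MinimalFreeResolution.rank_eq_zero_of_rank_succ {M : Type u} [AddCommGroup M] [Module R M]
    (P : MinimalFreeResolution R M) {d : ℕ} (hR : depth R R = d)
    (hM : ∀ i < d, Subsingleton (ExtModule R (ResidueField R) M i)) {n : ℕ}
    (h : P.rank (n + 2) = 0) : P.rank (n + 1) = 0 := by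
  have hinj : Function.Injective (P.d n) := by
    rw [← LinearMap.ker_eq_bot, LinearMap.exact_iff.mp (P.exact_d n), LinearMap.range_eq_bot]
    have : IsEmpty (Fin (P.rank (n + 2))) := by rw [h]; infer_instance
    ext v
    exact isEmptyElim v
  have hex : Function.Exact (P.d n) (P.cover n) := LinearMap.exact_iff.mpr (P.ker_cover n)
  have hsub : Subsingleton
      (ExtModule R (ResidueField R) (Fin (P.rank (n + 1)) → R) d) := by
    refine subsingleton_of_forall_eq 0 fun x ↦ ?_
    have hx := ext_residueField_comp_eq_zero (P.minimal n) x
    cases d with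
    | zero =>
      -- For d = 0 there is no connecting map; left exactness of Hom suffices.
      have : Mono (ModuleCat.ofHom (P.d n)) := (ModuleCat.mono_iff_injective _).mpr hinj
      exact (injective_iff_map_eq_zero _).mp
        (Abelian.Ext.postcomp_mk₀_injective_of_mono _ (ModuleCat.ofHom (P.d n))) x hx
    | succ d =>
      obtain ⟨y, rfl⟩ := Abelian.Ext.covariant_sequence_exact₁ _
        (shortExact_of_exact hinj hex (P.cover_surjective n)) x hx rfl
      have := P.subsingleton_ext_syzygy_right (fun i hi ↦ subsingleton_ext_of_depth_eq hR hi) hM n d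
        (by omega)
      rw [@Subsingleton.elim _ this y 0, Abelian.Ext.zero_comp]
  by_contra hr
  refine not_subsingleton_ext_of_depth_eq hR ?_
  let j : Fin (P.rank (n + 1)) := ⟨0, Nat.pos_of_ne_zero hr⟩
  exact subsingleton_ext_of_retract (LinearMap.single R (fun _ ↦ R) j) (LinearMap.proj j)
    (by ext; simp) hsub

theorem MinimalFreeResolution.bijective_of_rank_eq_zero {M : Type u} [AddCommGroup M] [Module R M]
    (P : MinimalFreeResolution R M) {d : ℕ} (hR : depth R R = d)
    (hM : ∀ i < d, Subsingleton (ExtModule R (ResidueField R) M i)) {n : ℕ}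
    (h : P.rank (n + 1) = 0) : Function.Bijective P.ε := by
  have h1 : P.rank 1 = 0 := by
    induction n with
    | zero => exact h
    | succ n ih => exact ih (P.rank_eq_zero_of_rank_succ hR hM h)
  refine ⟨?_, P.ε_surjective⟩
  rw [← LinearMap.ker_eq_bot, LinearMap.exact_iff.mp P.exact_ε, LinearMap.range_eq_bot]
  have : IsEmpty (Fin (P.rank 1)) := by rw [h1]; infer_instance
  ext v
  exact isEmptyElim v

end FiniteProjectiveDimension

/-! ### Gorenstein rings and freeness of the canonical module -/

section Gorenstein

variable {R : Type u} [CommRing R] [IsLocalRing R] [IsNoetherianRing R]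

omit [IsNoetherianRing R] in
theorem exists_injective_residueField {M : Type u} [AddCommGroup M] [Module R M]
    (h : ¬ Subsingleton (ExtModule R (ResidueField R) M 0)) :
    ∃ f : ResidueField R →ₗ[R] M, Function.Injective f := by
  rw [subsingleton_ext_zero_iff, not_subsingleton_iff_nontrivial] at h
  obtain ⟨f, hf⟩ := exists_ne (0 : ResidueField R →ₗ[R] M)
  have : IsSimpleModule R (ResidueField R) := by
    change IsSimpleModule R (R ⧸ maximalIdeal R)
    exact isSimpleModule_iff_isCoatom.mpr (maximalIdeal.isMaximal R).out
  exact ⟨f, (LinearMap.injective_or_eq_zero f).resolve_right hf⟩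

/-- Modulo a maximal regular sequence, the residue field embeds. -/
theorem exists_injective_residueField_quotient {d : ℕ} (hR : depth R R = d) {rs : List R}
    (hlen : rs.length = d) (hmem : ∀ r ∈ rs, r ∈ maximalIdeal R)
    (hreg : RingTheory.Sequence.IsRegular R rs) :
    ∃ f : ResidueField R →ₗ[R] R ⧸ (Ideal.ofList rs • ⊤ : Submodule R R),
      Function.Injective f := by
  refine exists_injective_residueField fun h ↦ ?_
  have : Nontrivial (R ⧸ (Ideal.ofList rs • ⊤ : Submodule R R)) :=
    hreg.quot_ofList_smul_nontrivial ⊤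
  -- If Hom(k, R/(rs)) were zero, the sequence could be prolonged beyond the depth.
  obtain ⟨as, hlen', hmem', hreg'⟩ := exists_isRegular_of_subsingleton_ext (n := 1) (R := R)
    (M := R ⧸ (Ideal.ofList rs • ⊤ : Submodule R R))
    fun i hi ↦ by rwa [Nat.lt_one_iff.mp hi]
  have hmem'' : ∀ r ∈ rs ++ as, r ∈ maximalIdeal R := fun r hr ↦
    (List.mem_append.mp hr).elim (hmem r) (hmem' r)
  have := length_le_depth (M := R) hmem'' ((IsLocalRing.isRegular_iff_isWeaklyRegular_of_subset_maximalIdeal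
    hmem'').mpr ((RingTheory.Sequence.isWeaklyRegular_append_iff R rs as).mpr
      ⟨hreg.1, hreg'.1⟩))
  rw [List.length_append, hlen, hlen', hR] at this
  exact absurd (by exact_mod_cast this) (Nat.lt_succ_self d).not_ge

/-- The residue field embeds in R/(rs), which has projective dimension d. For i > d, Ext^i(k, K)
thus sits between Ext^i(R/(rs), K) = 0 and Ext^{i+1} of the cokernel, so any bound above d on the
injective dimension can be lowered by one. -/
theorem hasInjectiveDimensionLT_depth_succ {d : ℕ} (hR : depth R R = d) {K : Type u}
    [AddCommGroup K] [Module R K] [Module.Finite R K] {n : ℕ}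
    (h : HasInjectiveDimensionLT (ModuleCat.of R K) n) :
    HasInjectiveDimensionLT (ModuleCat.of R K) (d + 1) := by
  obtain ⟨rs, hlen, hmem, hreg⟩ := exists_isRegular_of_depth_eq hR
  obtain ⟨f, hf⟩ := exists_injective_residueField_quotient hR hlen hmem hreg
  have hpd : HasProjectiveDimensionLE
      (ModuleCat.of R (R ⧸ (Ideal.ofList rs • ⊤ : Submodule R R))) d := by
    rw [← projectiveDimension_le_iff]
    have := ModuleCat.projectiveDimension_quotient_eq_add_length_of_isWeaklyRegular
      (ModuleCat.of R R) rs hreg.1 hmem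
    rw [ModuleCat.projectiveDimension_eq_zero_of_projective (ModuleCat.of R R), hlen, zero_add] at this
    exact this.le
  have key (k : ℕ) : HasInjectiveDimensionLT (ModuleCat.of R K) (d + 1 + k) →
      HasInjectiveDimensionLT (ModuleCat.of R K) (d + 1) := by
    induction k with
    | zero => exact id
    | succ k ih =>
      intro hk
      refine ih ?_
      rw [show d + 1 + k = d + k + 1 by omega]
      refine hasInjectiveDimensionLT_of_subsingleton_ext_residueField fun i hi ↦ ?_
      refine subsingleton_ext_left_of_contravariant hf (LinearMap.exact_map_mkQ_range f)
        (Submodule.mkQ_surjective _) K ?_ ?_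
      · exact HasProjectiveDimensionLT.subsingleton _ (d + 1) i (by omega) _
      · exact HasInjectiveDimensionLT.subsingleton _ (d + 1 + (k + 1)) (i + 1) (by omega) _
  refine key n ?_
  exact hasInjectiveDimensionLT_of_ge _ n _ (by omega)

variable (ω : Type u) [AddCommGroup ω] [Module R ω]

omit [IsNoetherianRing R] in
theorem IsCanonicalModule.subsingleton_ext {ω : Type u} [AddCommGroup ω] [Module R ω]
    (hω : IsCanonicalModule R ω) {d : ℕ} (hd : ringKrullDim R = d) {i : ℕ} (hi : i ≠ d) :
    Subsingleton (ExtModule R (ResidueField R) ω i) := by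
  have := hω.length_ext i
  rw [if_neg (by rw [hd]; exact_mod_cast hi)] at this
  exact Module.length_eq_zero_iff.mp this

omit [IsNoetherianRing R] in
theorem IsCanonicalModule.not_subsingleton_ext {ω : Type u} [AddCommGroup ω] [Module R ω]
    (hω : IsCanonicalModule R ω) {d : ℕ} (hd : ringKrullDim R = d) :
    ¬ Subsingleton (ExtModule R (ResidueField R) ω d) := by
  intro h
  have := hω.length_ext d
  rw [if_pos hd.symm, Module.length_eq_zero_iff.mpr h] at this
  exact zero_ne_one this

variable {ω}

/-- Since Ext^d(k, ω) ≠ 0, the rank is positive, so R is a direct summand of ω and inherits the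
vanishing of Ext^i(k, -) above degree d. -/
theorem isGorenstein_of_free (hω : IsCanonicalModule R ω) {d : ℕ} (hd : ringKrullDim R = d)
    {r : ℕ} (e : (Fin r → R) ≃ₗ[R] ω) : IsGorenstein R := by
  have hr : r ≠ 0 := by
    rintro rfl
    refine hω.not_subsingleton_ext hd ((subsingleton_ext_congr_right e).mp ?_)
    refine subsingleton_of_forall_eq 0 fun x ↦ ?_
    rw [← x.comp_mk₀_id, (ModuleCat.isZero_of_subsingleton
      (ModuleCat.of R (Fin 0 → R))).eq_of_src (𝟙 _) 0, Abelian.Ext.mk₀_zero,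
      Abelian.Ext.comp_zero]
  let j : Fin r := ⟨0, Nat.pos_of_ne_zero hr⟩
  refine ⟨d, hasInjectiveDimensionLT_of_subsingleton_ext_residueField fun i hi ↦ ?_⟩
  exact subsingleton_ext_of_retract (LinearMap.single R (fun _ ↦ R) j) (LinearMap.proj j)
    (by ext; simp) ((subsingleton_ext_congr_right e).mpr (hω.subsingleton_ext hd (by omega)))

/-- All syzygies of ω have injective dimension at most d: the exact sequences give the bound d + 1,
which drops back to d. So Ext^{d+1}(ω, Ω_{d+1}) = 0, hence Ext¹(Ω_d, Ω_{d+1}) = 0 and Ω_{d+1} splits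
off F_d. As it lies in 𝔪F_d, it equals 𝔪Ω_{d+1}, and Nakayama applies. -/
theorem MinimalFreeResolution.rank_eq_zero_of_isGorenstein (P : MinimalFreeResolution R ω)
    (hω : IsCanonicalModule R ω) {d : ℕ} (hd : ringKrullDim R = d) (hR : depth R R = d)
    (hG : IsGorenstein R) : P.rank (d + 1) = 0 := by
  have := hω.finite
  obtain ⟨n, hn⟩ := hG
  have hRd := hasInjectiveDimensionLT_depth_succ hR hn
  have hfree (r : ℕ) : HasInjectiveDimensionLT (ModuleCat.of R (Fin r → R)) (d + 1) :=
    hasInjectiveDimensionLT_of_subsingleton_ext_quotient _ _ fun I ↦ subsingleton_ext_pi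
      (HasInjectiveDimensionLT.subsingleton _ _ _ le_rfl _)
  have hsyz (j : ℕ) : HasInjectiveDimensionLT (ModuleCat.of R (P.syzygy j)) (d + 1) := by
    induction j with
    | zero =>
      refine hasInjectiveDimensionLT_of_subsingleton_ext_quotient _ _ fun I ↦ ?_
      rw [subsingleton_ext_congr_right P.syzygyZeroEquiv]
      exact subsingleton_ext_quotient_of_residueField
        (fun i hi ↦ hω.subsingleton_ext hd (Nat.lt_of_succ_le hi).ne') I _ le_rfl
    | succ j ih =>
      have : Module.Finite R (P.syzygy (j + 1)) :=
        Module.Finite.of_surjective _ (P.cover_surjective (j + 1))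
      refine hasInjectiveDimensionLT_depth_succ hR (n := d + 2) ?_
      refine (shortExact_of_exact (P.inclusion_injective j) (P.exact_inclusion_cover j)
        (P.cover_surjective j)).hasInjectiveDimensionLT_X₁ (d + 1) ih ?_
      exact @hasInjectiveDimensionLT_of_ge _ _ _ _ _ _ (Nat.le_succ _) (hfree _)
  have hext : Subsingleton (ExtModule R (P.syzygy d) (P.syzygy (d + 1)) 1) :=
    P.subsingleton_ext_syzygy_left d 0
      (@HasInjectiveDimensionLT.subsingleton _ _ _ _ _ _ (hsyz (d + 1)) _ (by omega) _)
  obtain ⟨π, hπ⟩ := exists_extension_of_subsingleton_ext_one (P.inclusion_injective d)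
    (P.exact_inclusion_cover d) (P.cover_surjective d) hext LinearMap.id
  have : Module.Finite R (P.syzygy (d + 1)) :=
    Module.Finite.of_surjective _ (P.cover_surjective (d + 1))
  have hle : (⊤ : Submodule R (P.syzygy (d + 1))) ≤ maximalIdeal R • ⊤ := by
    intro x _
    have hx : P.inclusion d x ∈ maximalIdeal R • (⊤ : Submodule R (Fin (P.rank d) → R)) :=
      P.minimal d (P.range_inclusion d ▸ LinearMap.mem_range_self _ x)
    have := Submodule.mem_map_of_mem (f := π) hx
    rw [Submodule.map_smul''] at this
    have h' : π (P.inclusion d x) = x := congr($hπ x)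
    rw [h'] at this
    exact Submodule.smul_mono le_rfl le_top this
  have : Subsingleton (P.syzygy (d + 1)) := by
    have := Submodule.eq_bot_of_le_smul_of_le_jacobson_bot (maximalIdeal R) _
      Module.Finite.fg_top hle (IsLocalRing.maximalIdeal_le_jacobson _)
    exact (Submodule.subsingleton_iff R).mp (subsingleton_of_bot_eq_top this.symm)
  exact P.rank_succ_eq_zero_of_subsingleton

end Gorenstein

/-! ### From vanishing of `Tor` to vanishing of `Ext` into character modules -/

section Tor

variable {R : Type u} [CommRing R] {W L : Type u} [AddCommGroup W] [Module R W]
  [AddCommGroup L] [Module R L]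

/-- `TorModule` is derived in its second argument, so it is computed by resolving L and not W. -/
theorem subsingleton_tor_iff (Q : ProjectiveResolution (ModuleCat.of R L)) (n : ℕ) :
    Subsingleton (TorModule R W L (n + 1)) ↔
      Function.Exact ((Q.complex.d (n + 2) (n + 1)).hom.lTensor W)
        ((Q.complex.d (n + 1) n).hom.lTensor W) := by
  rw [← ModuleCat.isZero_iff_subsingleton]
  refine (Q.isoLeftDerivedObj ((MonoidalCategory.tensoringLeft (ModuleCat.{u} R)).obj
    (ModuleCat.of R W)) (n + 1)).isZero_iff.trans ?_
  refine (HomologicalComplex.exactAt_iff_isZero_homology _ _).symm.trans ?_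
  rw [HomologicalComplex.exactAt_iff' _ (n + 2) (n + 1) n (by simp) (by simp),
    ShortComplex.ShortExact.moduleCat_exact_iff_function_exact]
  rfl

theorem subsingleton_tor_of_flat [Module.Flat R W] (n : ℕ) :
    Subsingleton (TorModule R W L (n + 1)) := by
  rw [subsingleton_tor_iff (ProjectiveResolution.of (ModuleCat.of R L))]
  exact Module.Flat.lTensor_exact W
    ((ShortComplex.ShortExact.moduleCat_exact_iff_function_exact _).mp
      ((ProjectiveResolution.of (ModuleCat.of R L)).exact_succ n))

theorem subsingleton_ext_characterModule_of_flat {G : Type u} [AddCommGroup G] [Module R G]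
    [Module.Flat R G] (n : ℕ) : Subsingleton (ExtModule R W (CharacterModule G) (n + 1)) := by
  have : Module.Injective R (CharacterModule G) :=
    Module.Baer.iff_injective.mp (Module.Flat.iff_characterModule_baer.mp inferInstance)
  have : Injective (ModuleCat.of R (CharacterModule G)) :=
    (Module.injective_iff_injective_object R (CharacterModule G)).mp inferInstance
  exact HasInjectiveDimensionLT.subsingleton _ 1 _ (by omega) _

theorem exact_characterModule_dual {A B C : Type u} [AddCommGroup A] [AddCommGroup B]
    [AddCommGroup C] [Module R A] [Module R B] [Module R C] {f : A →ₗ[R] B} {g : B →ₗ[R] C}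
    (hfg : Function.Exact f g) (hg : Function.Surjective g) :
    Function.Exact (CharacterModule.dual g) (CharacterModule.dual f) := by
  intro c
  constructor
  · intro hc
    have hle : AddMonoidHom.ker g.toAddMonoidHom ≤ AddMonoidHom.ker (c : B →+ AddCircle (1 : ℚ)) := by
      intro b hb
      obtain ⟨a, rfl⟩ := (hfg b).mp hb
      exact DFunLike.congr_fun hc a
    refine ⟨AddMonoidHom.liftOfSurjective g.toAddMonoidHom hg ⟨c, hle⟩, ?_⟩
    exact AddMonoidHom.liftOfRightInverse_comp _ _ _ ⟨c, hle⟩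
  · rintro ⟨b, rfl⟩
    ext a
    change b (g (f a)) = 0
    rw [hfg.apply_apply_eq_zero, map_zero]

/-- Dualising gives 0 → L* → B* → A* → 0 with Ext¹(W, B*) = 0, so a class comes from a map W → A*,
that is, a character of W ⊗ A. It extends along the injection into W ⊗ B because ℚ/ℤ is injective;
the map lifts to B* and the class is zero. -/
theorem subsingleton_ext_characterModule_one {A B : Type u} [AddCommGroup A] [AddCommGroup B]
    [Module R A] [Module R B] [Module.Flat R B] {f : A →ₗ[R] B} {g : B →ₗ[R] L}
    (hf : Function.Injective f) (hfg : Function.Exact f g) (hg : Function.Surjective g)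
    (h : Function.Injective (f.lTensor W)) :
    Subsingleton (ExtModule R W (CharacterModule L) 1) := by
  refine subsingleton_of_forall_eq 0 fun x ↦ ?_
  have hS := shortExact_of_exact (CharacterModule.dual_injective_of_surjective g hg)
    (exact_characterModule_dual hfg hg) (CharacterModule.dual_surjective_of_injective f hf)
  obtain ⟨y, rfl⟩ := Abelian.Ext.covariant_sequence_exact₁ _ hS x
    (@Subsingleton.elim _ (subsingleton_ext_characterModule_of_flat (W := W) (G := B) 0) _ _) rfl
  obtain ⟨φ, rfl⟩ := Abelian.Ext.homEquiv₀.symm.surjective y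
  obtain ⟨c, hc⟩ := CharacterModule.dual_surjective_of_injective _ h
    (CharacterModule.homEquiv φ.hom)
  have hψ : φ = ModuleCat.ofHom (CharacterModule.homEquiv.symm c) ≫
      ModuleCat.ofHom (CharacterModule.dual f) := by
    ext w : 2
    refine DFunLike.ext _ _ fun a ↦ ?_
    have := DFunLike.congr_fun hc (TensorProduct.tmul R w a)
    exact this.symm
  rw [hψ]
  have := Abelian.Ext.mk₀_comp_mk₀ (ModuleCat.ofHom (CharacterModule.homEquiv.symm c))
      (ModuleCat.ofHom (CharacterModule.dual f))
  simp only [Abelian.Ext.homEquiv₀_symm_apply]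
  rw [← this, Abelian.Ext.comp_assoc _ _ _ (add_zero 0) (zero_add 1) (by omega)]
  rw [hS.comp_extClass, Abelian.Ext.comp_zero]

theorem injective_lTensor_of_exact {A B C : Type u} [AddCommGroup A] [AddCommGroup B]
    [AddCommGroup C] [Module R A] [Module R B] [Module R C] {f : A →ₗ[R] B} {g : B →ₗ[R] C}
    (hfg : ∀ x, g (f x) = 0) (h : Function.Exact (f.lTensor W) (g.lTensor W)) :
    Function.Injective ((LinearMap.range g).subtype.lTensor W) := by
  rw [injective_iff_map_eq_zero]
  intro t ht
  obtain ⟨s, rfl⟩ := LinearMap.lTensor_surjective W g.surjective_rangeRestrict t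
  rw [← LinearMap.comp_apply, ← LinearMap.lTensor_comp] at ht
  obtain ⟨s, rfl⟩ := (h s).mp ht
  rw [← LinearMap.comp_apply, ← LinearMap.lTensor_comp]
  have : g.rangeRestrict ∘ₗ f = 0 := LinearMap.ext fun x ↦ Subtype.ext (hfg x)
  rw [this, LinearMap.lTensor_zero, LinearMap.zero_apply]

/-- Dimension shifting along the image of `δ 0`. Using a bare sequence of flat modules lets the
induction drop its first term. -/
theorem subsingleton_ext_characterModule_of_exact (n : ℕ) (G : ℕ → Type u)
    [∀ i, AddCommGroup (G i)] [∀ i, Module R (G i)] [∀ i, Module.Flat R (G i)]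
    (δ : ∀ i, G (i + 1) →ₗ[R] G i) (π : G 0 →ₗ[R] L) (hπ : Function.Surjective π)
    (h0 : Function.Exact (δ 0) π) (hδ : ∀ i, Function.Exact (δ (i + 1)) (δ i))
    (h : Function.Exact ((δ (n + 1)).lTensor W) ((δ n).lTensor W)) :
    Subsingleton (ExtModule R W (CharacterModule L) (n + 1)) := by
  induction n generalizing L G with
  | zero =>
    refine subsingleton_ext_characterModule_one (LinearMap.range (δ 0)).injective_subtype
      ?_ hπ (injective_lTensor_of_exact (fun x ↦ (hδ 0).apply_apply_eq_zero x) h)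
    rw [LinearMap.exact_iff, Submodule.range_subtype, LinearMap.exact_iff.mp h0]
  | succ n ih =>
    have := ih (L := LinearMap.range (δ 0)) (fun i ↦ G (i + 1)) (fun i ↦ δ (i + 1))
      (δ 0).rangeRestrict (δ 0).surjective_rangeRestrict (by
        rw [LinearMap.exact_iff, LinearMap.ker_rangeRestrict, LinearMap.exact_iff.mp (hδ 0)])
      (fun i ↦ hδ (i + 1)) h
    have hex : Function.Exact (LinearMap.range (δ 0)).subtype π := by
      rw [LinearMap.exact_iff, Submodule.range_subtype, LinearMap.exact_iff.mp h0]
    exact subsingleton_ext_left_of_covariant (CharacterModule.dual_injective_of_surjective _ hπ)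
      (exact_characterModule_dual hex hπ)
      (CharacterModule.dual_surjective_of_injective _ (LinearMap.range (δ 0)).injective_subtype) W
      this (subsingleton_ext_characterModule_of_flat _)

theorem subsingleton_ext_characterModule_of_tor {n : ℕ}
    (h : Subsingleton (TorModule R W L (n + 1))) :
    Subsingleton (ExtModule R W (CharacterModule L) (n + 1)) := by
  let Q := ProjectiveResolution.of (ModuleCat.of R L)
  have (i : ℕ) : Module.Flat R (Q.complex.X i) := by
    have : Module.Projective R (Q.complex.X i) :=
      (IsProjective.iff_projective (Q.complex.X i)).mpr (Q.projective i)
    infer_instance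
  refine subsingleton_ext_characterModule_of_exact n (fun i ↦ Q.complex.X i)
    (fun i ↦ (Q.complex.d (i + 1) i).hom) (Q.π.f 0).hom
    ((ModuleCat.epi_iff_surjective _).mp inferInstance)
    ((ShortComplex.ShortExact.moduleCat_exact_iff_function_exact _).mp Q.exact₀)
    (fun i ↦ (ShortComplex.ShortExact.moduleCat_exact_iff_function_exact _).mp (Q.exact_succ i))
    ((subsingleton_tor_iff Q n).mp h)

end Tor

/-! ### Complexes of matrices with coefficients in a module -/

section

open scoped Pointwise

section MatrixMap

variable {R : Type*} [CommRing R] {a b c : ℕ}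

/-- The map `M ^ b → M ^ a` given by a matrix over the base ring. -/
def matrixMap (A : Matrix (Fin a) (Fin b) R) (M : Type*) [AddCommGroup M] [Module R M] :
    (Fin b → M) →ₗ[R] (Fin a → M) :=
  LinearMap.pi fun i ↦ ∑ j, A i j • LinearMap.proj j

variable {M N : Type*} [AddCommGroup M] [Module R M] [AddCommGroup N] [Module R N]

theorem matrixMap_apply (A : Matrix (Fin a) (Fin b) R) (v : Fin b → M) (i : Fin a) :
    matrixMap A M v i = ∑ j, A i j • v j := by
  simp [matrixMap]

theorem matrixMap_comp_map (A : Matrix (Fin a) (Fin b) R) (f : M →ₗ[R] N) (v : Fin b → M) :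
    matrixMap A N (fun j ↦ f (v j)) = fun i ↦ f (matrixMap A M v i) := by
  ext i
  simp [matrixMap_apply]

theorem matrixMap_toMatrix' (f : (Fin b → R) →ₗ[R] (Fin a → R)) :
    matrixMap (LinearMap.toMatrix' f) R = f := by
  conv_rhs => rw [← Matrix.toLin'_toMatrix' f]
  refine LinearMap.ext fun v ↦ funext fun i ↦ ?_
  rw [matrixMap_apply, Matrix.toLin'_apply]
  rfl

theorem exact_matrixMap_baseChange {A : Matrix (Fin b) (Fin a) R} {B : Matrix (Fin c) (Fin b) R}
    (S : Type*) [CommRing S] [Algebra R S] [Module.Flat R S]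
    (h : Function.Exact (matrixMap A M) (matrixMap B M)) :
    Function.Exact (matrixMap (A.map (algebraMap R S)) (TensorProduct R S M))
      (matrixMap (B.map (algebraMap R S)) (TensorProduct R S M)) := by
  have comm {p q : ℕ} (C : Matrix (Fin p) (Fin q) R) :
      matrixMap (C.map (algebraMap R S)) (TensorProduct R S M) ∘ₗ
        (TensorProduct.piRight R S S fun _ : Fin q ↦ M).toLinearMap =
      (TensorProduct.piRight R S S fun _ : Fin p ↦ M).toLinearMap ∘ₗ
        (matrixMap C M).baseChange S := by
    refine TensorProduct.AlgebraTensorModule.curry_injective (LinearMap.ext fun s ↦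
      LinearMap.ext fun v ↦ funext fun i ↦ ?_)
    simp [matrixMap_apply, TensorProduct.tmul_sum]
  have h' : Function.Exact ((matrixMap A M).baseChange S) ((matrixMap B M).baseChange S) :=
    Module.Flat.lTensor_exact S h
  exact Function.Exact.of_ladder_linearEquiv_of_exact (comm A) (comm B) h'

/-- If v is a cycle modulo x, then B v = x w. Regularity of x makes w a cycle, so w = B y by
exactness one spot further, and v - x y is a genuine cycle. Hence two consecutive exact spots give
one exact spot modulo x. -/
theorem exact_matrixMap_quotSMulTop {e : ℕ} {A : Matrix (Fin b) (Fin a) R}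
    {B : Matrix (Fin c) (Fin b) R} {C : Matrix (Fin e) (Fin c) R} {x : R} (hx : IsSMulRegular M x)
    (hAB : Function.Exact (matrixMap A M) (matrixMap B M))
    (hBC : Function.Exact (matrixMap B M) (matrixMap C M)) :
    Function.Exact (matrixMap A (QuotSMulTop x M)) (matrixMap B (QuotSMulTop x M)) := by
  let q : M →ₗ[R] QuotSMulTop x M := Submodule.mkQ _
  have hq : Function.Surjective q := Submodule.mkQ_surjective _
  have hker (y : M) : q y = 0 ↔ ∃ z, x • z = y := by
    rw [← LinearMap.mem_ker, Submodule.ker_mkQ, Submodule.mem_smul_pointwise_iff_exists]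
    simp
  have lift {n : ℕ} (v : Fin n → QuotSMulTop x M) : ∃ w : Fin n → M, (fun j ↦ q (w j)) = v :=
    ⟨fun j ↦ (hq (v j)).choose, funext fun j ↦ (hq (v j)).choose_spec⟩
  intro v
  obtain ⟨v, rfl⟩ := lift v
  constructor
  · intro hv
    rw [matrixMap_comp_map] at hv
    choose w hw using fun i ↦ (hker _).mp (congrFun hv i)
    have hxw : x • w = matrixMap B M v := funext hw
    have hw0 : matrixMap C M w = 0 := by
      have : x • matrixMap C M w = 0 := by
        rw [← map_smul, hxw, hBC.apply_apply_eq_zero]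
      ext i
      exact hx (by simpa using congrFun this i)
    obtain ⟨y, rfl⟩ := (hBC w).mp hw0
    obtain ⟨t, ht⟩ := (hAB (v - x • y)).mp (by rw [map_sub, map_smul, hxw, sub_self])
    refine ⟨fun j ↦ q (t j), ?_⟩
    rw [matrixMap_comp_map, ht]
    ext i
    rw [Pi.sub_apply, map_sub, sub_eq_self]
    exact (hker _).mpr ⟨y i, rfl⟩
  · rintro ⟨t, ht⟩
    obtain ⟨t, rfl⟩ := lift t
    rw [← ht, matrixMap_comp_map, matrixMap_comp_map, hAB.apply_apply_eq_zero]
    ext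
    simp

end MatrixMap

section Vanishing

variable {S : Type u} [CommRing S] [IsLocalRing S]

theorem maximalIdeal_smul_top_quotSMulTop_le {M : Type u} [AddCommGroup M] [Module S M] {x : S}
    {rs : List S}
    (h : maximalIdeal S • (⊤ : Submodule S M) ≤ Ideal.ofList (x :: rs) • ⊤) :
    maximalIdeal S • (⊤ : Submodule S (QuotSMulTop x M)) ≤ Ideal.ofList rs • ⊤ := by
  have := Submodule.map_mono (f := (x • (⊤ : Submodule S M)).mkQ) h
  rw [Ideal.ofList_cons_smul, Submodule.map_sup, Submodule.map_smul'', Submodule.map_smul'',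
    Submodule.map_top, Submodule.range_mkQ, Submodule.map_pointwise_smul, Submodule.map_top,
    Submodule.range_mkQ] at this
  refine this.trans (sup_le ?_ le_rfl)
  rintro _ ⟨y, -, rfl⟩
  obtain ⟨y, rfl⟩ := Submodule.mkQ_surjective _ y
  have : x • (x • (⊤ : Submodule S M)).mkQ y = 0 := by
    rw [← map_smul, ← LinearMap.mem_ker, Submodule.ker_mkQ]
    exact Submodule.smul_mem_pointwise_smul _ _ _ trivial
  change x • (x • (⊤ : Submodule S M)).mkQ y ∈ _
  rw [this]
  exact Submodule.zero_mem _

/-- Both maps act as zero on M, so exactness between them leaves no room for a nonzero power of M.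
-/
theorem eq_zero_of_exact_matrixMap {M : Type u} [AddCommGroup M] [Module S M] [Nontrivial M]
    (hM : maximalIdeal S • (⊤ : Submodule S M) = ⊥) {a b c : ℕ} {A : Matrix (Fin b) (Fin a) S}
    {B : Matrix (Fin c) (Fin b) S} (hA : ∀ i j, A i j ∈ maximalIdeal S)
    (hB : ∀ i j, B i j ∈ maximalIdeal S)
    (h : Function.Exact (matrixMap A M) (matrixMap B M)) : b = 0 := by
  have key {p q : ℕ} {C : Matrix (Fin p) (Fin q) S} (hC : ∀ i j, C i j ∈ maximalIdeal S)
      (v : Fin q → M) : matrixMap C M v = 0 := by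
    ext i
    rw [matrixMap_apply]
    refine Finset.sum_eq_zero fun j _ ↦ ?_
    have := Submodule.smul_mem_smul (hC i j) (Submodule.mem_top (x := v j))
    rwa [hM] at this
  by_contra hb
  obtain ⟨y, hy⟩ := exists_ne (0 : M)
  obtain ⟨v, hv⟩ := (h (fun _ ↦ y)).mp (key hB _)
  rw [key hA] at hv
  exact hy (congrFun hv ⟨0, Nat.pos_of_ne_zero hb⟩).symm

/-- Each regular element costs the last exact spot, since lifting a cycle uses exactness at the next
one; the first spot survives. -/
theorem eq_zero_of_exact_cochain (r : ℕ → ℕ) (A : ∀ i, Matrix (Fin (r (i + 1))) (Fin (r i)) S)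
    (hA : ∀ i j k, A i j k ∈ maximalIdeal S) (rs : List S) :
    ∀ (M : Type u) [AddCommGroup M] [Module S M] (n : ℕ),
      RingTheory.Sequence.IsRegular M rs →
      maximalIdeal S • (⊤ : Submodule S M) ≤ Ideal.ofList rs • ⊤ →
      (∀ i, n ≤ i → i ≤ n + rs.length →
        Function.Exact (matrixMap (A i) M) (matrixMap (A (i + 1)) M)) → r (n + 1) = 0 := by
  induction rs with
  | nil =>
    intro M _ _ n hreg hle hex
    have := hreg.nontrivial
    exact eq_zero_of_exact_matrixMap (by simpa using hle) (hA n) (hA (n + 1)) (hex n le_rfl le_rfl)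
  | cons x rs ih =>
    intro M _ _ n hreg hle hex
    rw [RingTheory.Sequence.isRegular_cons_iff] at hreg
    rw [List.length_cons] at hex
    exact ih _ n hreg.2 (maximalIdeal_smul_top_quotSMulTop_le hle) fun i h1 h2 ↦
      exact_matrixMap_quotSMulTop hreg.1 (hex i h1 (by omega)) (hex (i + 1) (by omega) (by omega))

/-- Here the next spot has lower degree, so the window loses its lowest spot at each step and the
highest one survives. -/
theorem eq_zero_of_exact_chain (r : ℕ → ℕ) (B : ∀ i, Matrix (Fin (r i)) (Fin (r (i + 1))) S)
    (hB : ∀ i j k, B i j k ∈ maximalIdeal S) (rs : List S) :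
    ∀ (M : Type u) [AddCommGroup M] [Module S M] (n : ℕ),
      RingTheory.Sequence.IsRegular M rs →
      maximalIdeal S • (⊤ : Submodule S M) ≤ Ideal.ofList rs • ⊤ →
      (∀ i, n ≤ i → i ≤ n + rs.length →
        Function.Exact (matrixMap (B (i + 1)) M) (matrixMap (B i) M)) →
      r (n + rs.length + 1) = 0 := by
  induction rs with
  | nil =>
    intro M _ _ n hreg hle hex
    have := hreg.nontrivial
    exact eq_zero_of_exact_matrixMap (by simpa using hle) (hB (n + 1)) (hB n) (hex n le_rfl le_rfl)
  | cons x rs ih =>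
    intro M _ _ n hreg hle hex
    rw [RingTheory.Sequence.isRegular_cons_iff] at hreg
    rw [List.length_cons] at hex ⊢
    rw [show n + (rs.length + 1) + 1 = n + 1 + rs.length + 1 by omega]
    refine ih _ (n + 1) hreg.2 (maximalIdeal_smul_top_quotSMulTop_le hle) fun i h1 h2 ↦ ?_
    obtain ⟨i, rfl⟩ := Nat.exists_eq_succ_of_ne_zero (by omega : i ≠ 0)
    exact exact_matrixMap_quotSMulTop hreg.1 (hex (i + 1) (by omega) (by omega))
      (hex i (by omega) (by omega))

end Vanishing

/-! ### The complexes Hom(P, L) and P ⊗ L as matrix complexes -/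

section ResolutionMatrices

variable {R : Type u} [CommRing R] [IsLocalRing R] {W L : Type u} [AddCommGroup W] [Module R W]
  [AddCommGroup L] [Module R L] (P : MinimalFreeResolution R W)

/-- The matrix of a differential of a free resolution. -/
noncomputable def MinimalFreeResolution.matrix (n : ℕ) :
    Matrix (Fin (P.rank n)) (Fin (P.rank (n + 1))) R :=
  LinearMap.toMatrix' (P.d n)

theorem MinimalFreeResolution.matrix_mem (n : ℕ) (i j) : P.matrix n i j ∈ maximalIdeal R := by
  rw [matrix, LinearMap.toMatrix'_apply]
  exact mem_smul_top_pi_iff.mp (P.minimal n ⟨_, rfl⟩) i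

omit [IsLocalRing R] in
theorem linearCombination_comp {a b : ℕ} (f : (Fin b → R) →ₗ[R] (Fin a → R)) (v : Fin a → L) :
    Fintype.linearCombination R v ∘ₗ f =
      Fintype.linearCombination R (matrixMap (LinearMap.toMatrix' f).transpose L v) := by
  ext j
  simp [Fintype.linearCombination_apply, matrixMap_apply, LinearMap.toMatrix'_apply]

/-- A cocycle is a map that factors through the syzygy Ω_{n+1}. It extends over the preceding free
module because Ext¹(Ω_n, L) = 0 by dimension shifting. -/
theorem MinimalFreeResolution.exact_matrixMap_transpose {n : ℕ}
    (h : Subsingleton (ExtModule R W L (n + 1))) :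
    Function.Exact (matrixMap (P.matrix n).transpose L)
      (matrixMap (P.matrix (n + 1)).transpose L) := by
  have hinj {a : ℕ} {v w : Fin a → L}
      (hvw : Fintype.linearCombination R v = Fintype.linearCombination R w) : v = w := by
    ext j
    have := congr($hvw (Pi.single j 1))
    simpa [Fintype.linearCombination_apply, Pi.single_apply] using this
  have hzero {a : ℕ} : Fintype.linearCombination R (0 : Fin a → L) = 0 := by
    ext; simp
  have h1 : Subsingleton (ExtModule R (P.syzygy n) L 1) :=
    P.subsingleton_ext_syzygy_left n 0 (by rwa [show 0 + 1 + n = n + 1 by omega])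
  intro v
  constructor
  · intro hv
    have hφ : Fintype.linearCombination R v ∘ₗ P.d (n + 1) = 0 := by
      rw [linearCombination_comp]
      exact (congrArg _ hv).trans hzero
    have hle : LinearMap.ker (P.cover (n + 1)) ≤
        LinearMap.ker (Fintype.linearCombination R v) := by
      rw [P.ker_cover]
      exact LinearMap.range_le_ker_iff.mpr hφ
    let φ : P.syzygy (n + 1) →ₗ[R] L :=
      (LinearMap.ker (P.cover (n + 1))).liftQ _ hle ∘ₗ
        ((P.cover (n + 1)).quotKerEquivOfSurjective (P.cover_surjective (n + 1))).symm.toLinearMap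
    obtain ⟨ψ, hψ⟩ := exists_extension_of_subsingleton_ext_one (P.inclusion_injective n)
      (P.exact_inclusion_cover n) (P.cover_surjective n) h1 φ
    refine ⟨fun j ↦ ψ (Pi.single j 1), hinj ?_⟩
    refine (linearCombination_comp (P.d n) _).symm.trans ?_
    have h2 : Fintype.linearCombination R (fun j ↦ ψ (Pi.single j 1)) = ψ := by
      ext j
      simp [Fintype.linearCombination_apply, Pi.single_apply]
    rw [h2, ← P.inclusion_comp_cover, ← LinearMap.comp_assoc, hψ]
    refine LinearMap.ext fun x ↦ ?_
    change (LinearMap.ker (P.cover (n + 1))).liftQ _ hle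
      (((P.cover (n + 1)).quotKerEquivOfSurjective (P.cover_surjective (n + 1))).symm
        (P.cover (n + 1) x)) = _
    have h3 : ((P.cover (n + 1)).quotKerEquivOfSurjective (P.cover_surjective (n + 1))).symm
        (P.cover (n + 1) x) = Submodule.Quotient.mk x := by
      rw [LinearEquiv.symm_apply_eq]
      rfl
    rw [h3, Submodule.liftQ_apply]
  · rintro ⟨w, rfl⟩
    refine hinj ?_
    refine (linearCombination_comp (P.d (n + 1)) _).symm.trans ?_
    have := linearCombination_comp (P.d n) w
    refine Eq.trans ?_ hzero.symm
    change Fintype.linearCombination R (matrixMap (LinearMap.toMatrix' (P.d n)).transpose L w) ∘ₗ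
      P.d (n + 1) = 0
    rw [← this, LinearMap.comp_assoc, (P.exact_d n).linearMap_comp_eq_zero, LinearMap.comp_zero]

omit [IsLocalRing R] in
theorem character_matrixMap {a b : ℕ} (A : Matrix (Fin a) (Fin b) R)
    (c : Fin a → CharacterModule L) (v : Fin b → L) :
    ∑ j, matrixMap A.transpose (CharacterModule L) c j (v j) = ∑ i, c i (matrixMap A L v i) := by
  have h (j : Fin b) : matrixMap A.transpose (CharacterModule L) c j (v j) =
      ∑ i, c i (A i j • v j) := by
    rw [matrixMap_apply]
    exact map_sum (AddMonoidHom.eval (v j) : (L →+ AddCircle (1 : ℚ)) →+ AddCircle (1 : ℚ))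
      (fun i ↦ A.transpose j i • c i) Finset.univ
  simp_rw [h, matrixMap_apply, map_sum]
  rw [Finset.sum_comm]

omit [IsLocalRing R] in
-- A cycle outside the image is detected by a character killing the image. Its components f form a
-- cocycle over L*, so f is the transpose of B applied to some g; by adjointness f then vanishes on
-- the cycle.
theorem exact_matrixMap_of_characterModule {a b c : ℕ} {A : Matrix (Fin b) (Fin a) R}
    {B : Matrix (Fin c) (Fin b) R} (hBA : B * A = 0)
    (h : Function.Exact (matrixMap B.transpose (CharacterModule L))
      (matrixMap A.transpose (CharacterModule L))) :
    Function.Exact (matrixMap A L) (matrixMap B L) := by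
  intro v
  constructor
  · intro hv
    by_contra hne
    have hne' : Submodule.Quotient.mk (p := LinearMap.range (matrixMap A L)) v ≠ 0 := by
      rwa [Ne, Submodule.Quotient.mk_eq_zero]
    obtain ⟨χ, hχ⟩ := CharacterModule.exists_character_apply_ne_zero_of_ne_zero hne'
    let χ' : (Fin b → L) →+ AddCircle (1 : ℚ) :=
      (χ : _ →+ AddCircle (1 : ℚ)).comp (LinearMap.range (matrixMap A L)).mkQ.toAddMonoidHom
    let f : Fin b → CharacterModule L := fun j ↦ χ'.comp (AddMonoidHom.single (fun _ ↦ L) j)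
    have hf (w : Fin b → L) : ∑ j, f j (w j) = χ' w := by
      have : w = ∑ j, Pi.single j (w j) := (Finset.univ_sum_single w).symm
      conv_rhs => rw [this, map_sum]
      rfl
    have hf0 : matrixMap A.transpose (CharacterModule L) f = 0 := by
      ext j y
      have h1 := character_matrixMap A f (Pi.single j y)
      rw [hf, Finset.sum_eq_single j, Pi.single_eq_same] at h1
      · refine h1.trans ?_
        change χ (Submodule.Quotient.mk _) = 0
        rw [(Submodule.Quotient.mk_eq_zero _).mpr (LinearMap.mem_range_self _ _), map_zero]
      · intro k _ hk
        rw [Pi.single_eq_of_ne hk, map_zero]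
      · simp
    obtain ⟨g, hg⟩ := (h f).mp hf0
    refine hχ ?_
    change χ' v = 0
    rw [← hf, ← hg, character_matrixMap, hv]
    simp
  · rintro ⟨w, rfl⟩
    ext i
    rw [matrixMap_apply]
    simp_rw [matrixMap_apply, Finset.smul_sum, smul_smul]
    rw [Finset.sum_comm]
    simp_rw [← Finset.sum_smul]
    refine Finset.sum_eq_zero fun k _ ↦ ?_
    have : ∑ j, B i j * A j k = 0 := congrFun (congrFun hBA i) k
    rw [this, zero_smul]

theorem MinimalFreeResolution.matrix_mul_matrix (n : ℕ) :
    P.matrix n * P.matrix (n + 1) = 0 := by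
  rw [matrix, matrix, ← LinearMap.toMatrix'_comp, (P.exact_d n).linearMap_comp_eq_zero, map_zero]

/-- Balancing of `Tor`: the hypothesis is about resolutions of L, the conclusion about the
resolution P of W. The detour through the character module of L makes P usable. -/
theorem MinimalFreeResolution.exact_matrixMap {n : ℕ}
    (h : Subsingleton (TorModule R W L (n + 1))) :
    Function.Exact (matrixMap (P.matrix (n + 1)) L) (matrixMap (P.matrix n) L) :=
  exact_matrixMap_of_characterModule (P.matrix_mul_matrix n)
    (P.exact_matrixMap_transpose (subsingleton_ext_characterModule_of_tor h))

end ResolutionMatrices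

end

/-! ### The resolution of the residue field modulo a superficial sequence -/

section SuperficialSequence

variable {S : Type*} [CommRing S] [IsLocalRing S]

/-- A sequence of elements of the maximal ideal which is regular modulo `I`, independent modulo
`𝔪 ^ 2 + I`, and superficial at each step. -/
def IsSuperficialSequence (I : Ideal S) : List S → Prop
  | [] => True
  | x :: rs => x ∈ maximalIdeal S ∧ x ∉ maximalIdeal S ^ 2 ⊔ I ∧ (∀ c, x * c ∈ I → c ∈ I) ∧
      (∃ j₀, ∀ j, j₀ ≤ j → ∀ c, x * c ∈ maximalIdeal S ^ (j + 1) ⊔ I →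
        c ∈ maximalIdeal S ^ j ⊔ I) ∧
      IsSuperficialSequence (I ⊔ Ideal.span {x}) rs

omit [IsLocalRing S] in
theorem forall_mem_of_linearMap {a b : ℕ} (f : (Fin a → S) →ₗ[S] (Fin b → S)) {I : Ideal S}
    {v : Fin a → S} (hv : ∀ i, v i ∈ I) (j : Fin b) : f v j ∈ I := by
  refine mem_smul_top_pi_iff.mp ?_ j
  have := Submodule.mem_map_of_mem (f := f) (mem_smul_top_pi_iff.mpr hv)
  rw [Submodule.map_smul''] at this
  exact Submodule.smul_mono le_rfl le_top this

omit [IsLocalRing S] in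
theorem forall_mem_sq_of_linearMap {a b : ℕ} (f : (Fin a → S) →ₗ[S] (Fin b → S)) {I : Ideal S}
    (hf : ∀ v j, f v j ∈ I) {v : Fin a → S} (hv : ∀ i, v i ∈ I) (j : Fin b) : f v j ∈ I ^ 2 := by
  refine mem_smul_top_pi_iff.mp ?_ j
  have := Submodule.mem_map_of_mem (f := f) (mem_smul_top_pi_iff.mpr hv)
  rw [Submodule.map_smul''] at this
  rw [pow_two, Submodule.mul_smul]
  refine Submodule.smul_mono le_rfl ?_ this
  rintro _ ⟨w, -, rfl⟩
  exact mem_smul_top_pi_iff.mpr (hf w)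

/-- The complex `D` has the property that, modulo `I`, cycles with entries in the maximal ideal
are boundaries. -/
def MinimalCyclesAreBoundaries {r : ℕ → ℕ} (D : ∀ n, (Fin (r (n + 1)) → S) →ₗ[S] (Fin (r n) → S))
    (I : Ideal S) : Prop :=
  ∀ n z, (∀ i, z i ∈ maximalIdeal S) → (∀ i, D n z i ∈ I) → ∃ v, ∀ i, (z - D (n + 1) v) i ∈ I

variable {r : ℕ → ℕ} {D : ∀ n, (Fin (r (n + 1)) → S) →ₗ[S] (Fin (r n) → S)}
  (hmin : ∀ n v i, D n v i ∈ maximalIdeal S)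
  (hD : ∀ n, Function.Exact (D (n + 1)) (D n))
  (h0 : ∀ v, (∀ i, v i ∈ maximalIdeal S) → ∃ w, D 0 w = v)

include hmin hD h0

/-- Write D z = x w modulo I. As D z has entries in 𝔪² and x is outside 𝔪² + I, no entry of w is a
unit. Regularity of x makes w a cycle modulo I, so w = D v modulo I, and z - x v is a cycle modulo I
with entries in 𝔪. -/
theorem MinimalCyclesAreBoundaries.sup_span {I : Ideal S} (h : MinimalCyclesAreBoundaries D I)
    {x : S} (hx : x ∈ maximalIdeal S) (hx2 : x ∉ maximalIdeal S ^ 2 ⊔ I)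
    (hreg : ∀ c, x * c ∈ I → c ∈ I) :
    MinimalCyclesAreBoundaries D (I ⊔ Ideal.span {x}) := by
  intro n z hz hDz
  have hsplit (i) : ∃ w, D n z i - x * w ∈ I := by
    obtain ⟨a, ha, b, hb, hab⟩ := Submodule.mem_sup.mp (hDz i)
    obtain ⟨c, rfl⟩ := Ideal.mem_span_singleton'.mp hb
    refine ⟨c, ?_⟩
    rw [← hab, mul_comm x, add_sub_cancel_right]
    exact ha
  choose w hw using hsplit
  have hwm (i) : w i ∈ maximalIdeal S := by
    by_contra hu
    obtain ⟨u, hu⟩ := (notMem_maximalIdeal.mp hu).exists_right_inv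
    have h1 := forall_mem_sq_of_linearMap (D n) (hmin n) hz i
    have h2 : x * w i ∈ maximalIdeal S ^ 2 ⊔ I := by
      have := Ideal.sub_mem _ (Ideal.mem_sup_left (T := I) h1)
        (Ideal.mem_sup_right (S := maximalIdeal S ^ 2) (hw i))
      simpa using this
    refine hx2 ?_
    have := Ideal.mul_mem_right u _ h2
    rwa [mul_assoc, hu, mul_one] at this
  obtain ⟨v, hv⟩ : ∃ v, ∀ i, (w - D n v) i ∈ I := by
    cases n with
    | zero =>
      -- At the bottom of the complex no differential is left to apply to w; `h0` replaces the cycle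
      -- condition.
      obtain ⟨v, hv⟩ := h0 w hwm
      exact ⟨v, fun i ↦ by simp [hv]⟩
    | succ n =>
      refine h n w hwm fun i ↦ hreg _ ?_
      have h1 := forall_mem_of_linearMap (D n) (v := D (n + 1) z - x • w) hw i
      rw [map_sub, (hD n).apply_apply_eq_zero, zero_sub, map_smul] at h1
      simpa using h1
  obtain ⟨v', hv'⟩ := h n (z - x • v)
    (fun i ↦ Ideal.sub_mem _ (hz i) (Ideal.mul_mem_right _ _ hx)) fun i ↦ by
      have h1 := Ideal.add_mem _ (hw i) (Ideal.mul_mem_left _ x (hv i))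
      rw [map_sub, map_smul]
      convert h1 using 1
      simp
      ring
  refine ⟨v', fun i ↦ ?_⟩
  have h1 := Ideal.add_mem _ (Ideal.mem_sup_left (T := Ideal.span {x}) (hv' i))
    (Ideal.mem_sup_right (S := I) (Ideal.mul_mem_right (v i) _ (Ideal.mem_span_singleton_self x)))
  convert h1 using 1
  simp only [Pi.sub_apply, Pi.smul_apply, smul_eq_mul]
  ring

theorem MinimalCyclesAreBoundaries.sup_ofList {rs : List S} :
    ∀ {I : Ideal S}, IsSuperficialSequence I rs → MinimalCyclesAreBoundaries D I →
      MinimalCyclesAreBoundaries D (I ⊔ Ideal.ofList rs) := by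
  induction rs with
  | nil => intro I _ h; simpa using h
  | cons x rs ih =>
    intro I hrs h
    rw [Ideal.ofList_cons, ← sup_assoc]
    exact ih hrs.2.2.2.2 (h.sup_span hmin hD h0 hrs.1 hrs.2.1 hrs.2.2.1)

/-- If a superficial sequence generates an ideal containing `𝔪 ^ 2`, then modulo this sequence
all elements of `𝔪 F` are boundaries. -/
theorem exists_sub_mem_ofList {rs : List S} (hrs : IsSuperficialSequence ⊥ rs)
    (hsq : maximalIdeal S ^ 2 ≤ Ideal.ofList rs) (n : ℕ) (z : Fin (r n) → S)
    (hz : ∀ i, z i ∈ maximalIdeal S) : ∃ v, ∀ i, (z - D n v) i ∈ Ideal.ofList rs := by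
  cases n with
  | zero =>
    obtain ⟨v, hv⟩ := h0 z hz
    exact ⟨v, fun i ↦ by simp [hv]⟩
  | succ n =>
    have hbot : MinimalCyclesAreBoundaries D (⊥ : Ideal S) := by
      intro n z _ hz
      obtain ⟨v, hv⟩ := (hD n z).mp (funext hz)
      exact ⟨v, fun i ↦ by simp [hv]⟩
    have := hbot.sup_ofList hmin hD h0 hrs
    rw [bot_sup_eq] at this
    exact this n z hz fun i ↦ hsq (forall_mem_sq_of_linearMap (D n) (hmin n) hz i)

/-- The maps g j factor through cokernels of differentials. A vector of 𝔪F is a boundary modulo rs,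
and g j kills boundaries. -/
theorem maximalIdeal_smul_top_le_of_iSup_range {M : Type*} [AddCommGroup M] [Module S M]
    {rs : List S} (hrs : IsSuperficialSequence ⊥ rs)
    (hsq : maximalIdeal S ^ 2 ≤ Ideal.ofList rs) {ι : Type*} (n : ι → ℕ)
    (g : ∀ j, (Fin (r (n j)) → S) →ₗ[S] M) (hg : ∀ j, g j ∘ₗ D (n j) = 0)
    (htop : ⨆ j, LinearMap.range (g j) = ⊤) :
    maximalIdeal S • (⊤ : Submodule S M) ≤ Ideal.ofList rs • ⊤ := by
  rw [← htop, Submodule.smul_iSup]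
  refine iSup_le fun j ↦ Submodule.smul_le.mpr ?_
  rintro s hs _ ⟨u, rfl⟩
  obtain ⟨v, hv⟩ := exists_sub_mem_ofList hmin hD h0 hrs hsq (n j) (s • u)
    fun i ↦ Ideal.mul_mem_right _ _ hs
  have h1 : s • g j u = g j (s • u - D (n j) v) := by
    have : g j (D (n j) v) = 0 := congr($(hg j) v)
    rw [map_sub, this, sub_zero, map_smul]
  have h2 := Submodule.mem_map_of_mem (f := g j) (mem_smul_top_pi_iff.mpr hv)
  rw [Submodule.map_smul'', ← h1] at h2
  exact Submodule.smul_mono le_rfl (le_top.trans htop.ge) h2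

end SuperficialSequence

/-! ### Images of syzygies of the residue field after flat base change -/

section BaseChange

variable {R : Type u} [CommRing R] [IsLocalRing R] {S : Type u} [CommRing S] [IsLocalRing S]
  [Algebra R S]

omit [IsLocalRing R] [IsLocalRing S] in
theorem exact_matrixMap_algebra [Module.Flat R S] {a b c : ℕ} {A : Matrix (Fin b) (Fin a) R}
    {B : Matrix (Fin c) (Fin b) R} (h : Function.Exact (matrixMap A R) (matrixMap B R)) :
    Function.Exact (matrixMap (A.map (algebraMap R S)) S)
      (matrixMap (B.map (algebraMap R S)) S) := by
  let e : TensorProduct R S R ≃ₗ[S] S := TensorProduct.AlgebraTensorModule.rid R S S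
  let E (p : ℕ) := LinearEquiv.piCongrRight fun _ : Fin p ↦ e
  have comm {p q : ℕ} (C : Matrix (Fin p) (Fin q) S) :
      matrixMap C S ∘ₗ (E q).toLinearMap = (E p).toLinearMap ∘ₗ matrixMap C _ :=
    LinearMap.ext fun v ↦ matrixMap_comp_map C e.toLinearMap v
  exact Function.Exact.of_ladder_linearEquiv_of_exact (comm _) (comm _)
    (exact_matrixMap_baseChange S h)

/-- A homomorphic image of a direct sum of syzygies of the residue field becomes, after a flat base
change with `𝔪 S = 𝔫`, a module `M` such that `𝔫 M = (rs) M`, provided `𝔫 ^ 2 ⊆ (rs)`. -/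
theorem maximalIdeal_smul_top_le_of_isImage [Module.Flat R S]
    (hm : (maximalIdeal R).map (algebraMap R S) = maximalIdeal S)
    {rs : List S} (hrs : IsSuperficialSequence ⊥ rs)
    (hsq : maximalIdeal S ^ 2 ≤ Ideal.ofList rs) {L : Type u} [AddCommGroup L] [Module R L]
    (hL : IsImageOfResidueFieldSyzygies R L) :
    maximalIdeal S • (⊤ : Submodule S (TensorProduct R S L)) ≤ Ideal.ofList rs • ⊤ := by
  obtain ⟨P, t, n, f, hf⟩ := hL
  have hmat (i : ℕ) : matrixMap (P.matrix i) R = P.d i := matrixMap_toMatrix' _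
  -- D is the base change of P. Below, g' composes f with the covers of the syzygies, and g is its
  -- base change.
  let D : ∀ n, (Fin (P.rank (n + 1)) → S) →ₗ[S] (Fin (P.rank n) → S) :=
    fun n ↦ matrixMap ((P.matrix n).map (algebraMap R S)) S
  have hDmap (i : ℕ) (w : Fin (P.rank (i + 1)) → R) :
      D i (fun j ↦ algebraMap R S (w j)) = fun j ↦ algebraMap R S (P.d i w j) := by
    ext j
    rw [← hmat, matrixMap_apply, matrixMap_apply, map_sum]
    simp
  let g' : ∀ j, (Fin (P.rank (n j)) → R) →ₗ[R] L := fun j ↦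
    f ∘ₗ LinearMap.single R (fun j ↦ P.syzygy (n j)) j ∘ₗ P.cover (n j)
  have hg' (j) (w) : g' j (P.d (n j) w) = 0 := by
    have : P.cover (n j) (P.d (n j) w) = 0 := by
      rw [← LinearMap.mem_ker, P.ker_cover]
      exact ⟨w, rfl⟩
    change f (Pi.single j (P.cover (n j) (P.d (n j) w))) = 0
    rw [this, Pi.single_zero, map_zero]
  have htop' : ⨆ j, LinearMap.range (g' j) = ⊤ := by
    refine eq_top_iff.mpr fun y _ ↦ ?_
    obtain ⟨v, rfl⟩ := hf y
    rw [← Finset.univ_sum_single v, map_sum]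
    refine Submodule.sum_mem _ fun j _ ↦ Submodule.mem_iSup_of_mem j ?_
    obtain ⟨w, hw⟩ := P.cover_surjective (n j) (v j)
    exact ⟨w, congrArg (fun z ↦ f (Pi.single j z)) hw⟩
  let g : ∀ j, (Fin (P.rank (n j)) → S) →ₗ[S] TensorProduct R S L := fun j ↦
    Fintype.linearCombination S fun i ↦ TensorProduct.tmul R 1 (g' j (Pi.single i 1))
  have hgmap (j) (w : Fin (P.rank (n j)) → R) :
      g j (fun i ↦ algebraMap R S (w i)) = TensorProduct.tmul R 1 (g' j w) := by
    conv_rhs => rw [pi_eq_sum_univ' w, map_sum, TensorProduct.tmul_sum]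
    rw [Fintype.linearCombination_apply]
    refine Finset.sum_congr rfl fun i _ ↦ ?_
    rw [map_smul, TensorProduct.tmul_smul, algebraMap_smul]
  refine maximalIdeal_smul_top_le_of_iSup_range (D := D) ?_ ?_ ?_ hrs hsq n g ?_ ?_
  · intro i v j
    rw [matrixMap_apply]
    refine Ideal.sum_mem _ fun k _ ↦ Ideal.mul_mem_right _ _ ?_
    rw [← hm]
    exact Ideal.mem_map_of_mem _ (P.matrix_mem i j k)
  · intro i
    refine exact_matrixMap_algebra ?_
    rw [hmat, hmat]
    exact P.exact_d i
  -- Since 𝔪S is the maximal ideal of S, it suffices to treat vectors with a single nonzero entry,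
  -- taken from 𝔪; ε kills these because it takes values in the residue field.
  · intro v hv
    rw [← LinearMap.mem_range, pi_eq_sum_univ' v]
    refine Submodule.sum_mem _ fun i _ ↦ ?_
    have hle : maximalIdeal S ≤ Submodule.comap (LinearMap.toSpanSingleton S (Fin (P.rank 0) → S)
        (fun j ↦ if j = i then 1 else 0)) (LinearMap.range (D 0)) := by
      rw [← hm, Ideal.map_le_iff_le_comap]
      intro s hs
      have h1 : P.ε (Pi.single i s) = 0 := by
        rw [← mul_one s, ← smul_eq_mul, Pi.single_smul, map_smul]
        obtain ⟨y, hy⟩ := residue_surjective (P.ε (Pi.single i 1))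
        rw [← hy, Algebra.smul_def, ResidueField.algebraMap_eq, ← map_mul, residue_eq_zero_iff]
        exact Ideal.mul_mem_right _ _ hs
      obtain ⟨w, hw⟩ := (P.exact_ε _).mp h1
      refine ⟨fun j ↦ algebraMap R S (w j), ?_⟩
      rw [hDmap, hw]
      ext j
      simp [Pi.single_apply, apply_ite (algebraMap R S)]
    have := hle (hv i)
    rw [Submodule.mem_comap, LinearMap.toSpanSingleton_apply] at this
    convert this using 5
    exact Pi.single_apply _ _ _
  · intro j
    refine LinearMap.pi_ext' fun i ↦ LinearMap.ext_ring ?_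
    have h1 : (Pi.single i 1 : Fin (P.rank (n j + 1)) → S) =
        fun k ↦ algebraMap R S ((Pi.single i 1 : Fin (P.rank (n j + 1)) → R) k) := by
      ext k
      simp [Pi.single_apply, apply_ite (algebraMap R S)]
    change g j (D (n j) (Pi.single i 1)) = 0
    rw [h1, hDmap, hgmap, hg', TensorProduct.tmul_zero]
  · refine (Submodule.eq_top_iff'.mpr fun y ↦ ?_)
    induction y with
    | zero => exact Submodule.zero_mem _
    | add y z hy hz => exact Submodule.add_mem _ hy hz
    | tmul s y =>
      have h1 : TensorProduct.tmul R s y = s • TensorProduct.tmul R (1 : S) y := by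
        rw [TensorProduct.smul_tmul', smul_eq_mul, mul_one]
      rw [h1]
      clear h1
      refine Submodule.smul_mem _ _ ?_
      have hy : y ∈ ⨆ j, LinearMap.range (g' j) := htop' ▸ trivial
      induction hy using Submodule.iSup_induction' with
      | mem j y hy =>
        obtain ⟨w, rfl⟩ := hy
        exact Submodule.mem_iSup_of_mem j ⟨_, hgmap j w⟩
      | zero => rw [TensorProduct.tmul_zero]; exact Submodule.zero_mem _
      | add y z _ _ hy hz =>
        rw [TensorProduct.tmul_add]
        exact Submodule.add_mem _ hy hz

end BaseChange

/-! ### Lengths, Hilbert functions and minimal multiplicity -/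

section Length

variable {S : Type*} [CommRing S]

theorem exists_exact_quotient {A B : Ideal S} {x : S} (h : ∀ c, x * c ∈ B ↔ c ∈ A) :
    ∃ (f : (S ⧸ A) →ₗ[S] (S ⧸ B)) (g : (S ⧸ B) →ₗ[S] (S ⧸ B ⊔ Ideal.span {x})),
      Function.Injective f ∧ Function.Exact f g ∧ Function.Surjective g := by
  have hle : A ≤ Submodule.comap (LinearMap.mulLeft S x) B := fun c hc => (h c).mpr hc
  have hle' : B ≤ Submodule.comap (LinearMap.id : S →ₗ[S] S) (B ⊔ Ideal.span {x}) :=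
    fun c hc => Ideal.mem_sup_left hc
  refine ⟨Submodule.mapQ A B (LinearMap.mulLeft S x) hle,
    Submodule.mapQ B (B ⊔ Ideal.span {x}) LinearMap.id hle', ?_, ?_, ?_⟩
  · rw [← LinearMap.ker_eq_bot, LinearMap.ker_eq_bot']
    rintro ⟨c⟩ hc
    exact (Submodule.Quotient.mk_eq_zero A).mpr
      ((h c).mp ((Submodule.Quotient.mk_eq_zero B).mp hc))
  · rintro ⟨c⟩
    constructor
    · intro hc
      obtain ⟨a, ha, b, hb, rfl⟩ := Submodule.mem_sup.mp
        ((Submodule.Quotient.mk_eq_zero (B ⊔ Ideal.span {x})).mp hc)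
      obtain ⟨e, rfl⟩ := Ideal.mem_span_singleton'.mp hb
      refine ⟨Submodule.Quotient.mk e, (Submodule.Quotient.eq B).mpr ?_⟩
      have : x * e - (a + e * x) = -a := by ring
      simpa [this] using ha
    · rintro ⟨⟨e⟩, he⟩
      have he : x * e - c ∈ B := (Submodule.Quotient.eq B).mp he
      refine (Submodule.Quotient.mk_eq_zero (B ⊔ Ideal.span {x})).mpr ?_
      have : c = -(x * e - c) + e * x := by ring
      rw [LinearMap.id_apply, this]
      exact add_mem (Ideal.mem_sup_left (neg_mem he))
        (Ideal.mem_sup_right (Ideal.mul_mem_left _ _ (Ideal.mem_span_singleton_self x)))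
  · rintro ⟨c⟩
    exact ⟨Submodule.Quotient.mk c, rfl⟩

theorem length_quotient_add {A B : Ideal S} {x : S} (h : ∀ c, x * c ∈ B ↔ c ∈ A) :
    Module.length S (S ⧸ A) + Module.length S (S ⧸ B ⊔ Ideal.span {x}) =
      Module.length S (S ⧸ B) := by
  obtain ⟨f, g, hf, hfg, hg⟩ := exists_exact_quotient h
  exact (Module.length_eq_add_of_exact f g hf hg hfg).symm

theorem length_quotient_anti {A B : Ideal S} (h : A ≤ B) :
    Module.length S (S ⧸ B) ≤ Module.length S (S ⧸ A) :=
  Module.length_le_of_surjective (Submodule.factor h) (Submodule.factor_surjective h)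

theorem eq_of_length_quotient_le {A B : Ideal S} (h : A ≤ B)
    (hfin : Module.length S (S ⧸ B) ≠ ⊤)
    (hle : Module.length S (S ⧸ A) ≤ Module.length S (S ⧸ B)) : A = B := by
  have hex := Module.length_eq_add_of_exact (LinearMap.ker (Submodule.factor h)).subtype
    (Submodule.factor h) Subtype.val_injective (Submodule.factor_surjective h)
    (LinearMap.exact_subtype_ker_map _)
  have hz : Module.length S (LinearMap.ker (Submodule.factor h)) = 0 := by
    rw [hex] at hle
    lift Module.length S (S ⧸ B) to ℕ using hfin with b
    generalize Module.length S (LinearMap.ker (Submodule.factor h)) = a at hle ⊢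
    have ha : a ≠ ⊤ := by
      rintro rfl
      simp at hle
    lift a to ℕ using ha
    norm_cast at hle ⊢
    omega
  rw [Module.length_eq_zero_iff] at hz
  refine le_antisymm h fun b hb => (Submodule.Quotient.mk_eq_zero A).mp ?_
  exact congrArg Subtype.val (Subsingleton.elim
    (⟨Submodule.Quotient.mk b, (Submodule.Quotient.mk_eq_zero B).mpr hb⟩ :
      LinearMap.ker (Submodule.factor h)) 0)

variable [IsLocalRing S]

/-- The kernel of S/B → S/(B + x) is cyclic and killed by 𝔪. -/
theorem length_quotient_le_add_one {B : Ideal S} {x : S}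
    (h : ∀ c ∈ maximalIdeal S, x * c ∈ B) :
    Module.length S (S ⧸ B) ≤ Module.length S (S ⧸ B ⊔ Ideal.span {x}) + 1 := by
  rw [← length_quotient_add (A := Submodule.comap (LinearMap.mulLeft S x) B) (x := x) fun c => Iff.rfl,
    add_comm]
  gcongr
  have : IsSimpleModule S (S ⧸ maximalIdeal S) := isSimpleModule_iff_isCoatom.mpr
    (maximalIdeal.isMaximal S).out
  rw [← Module.length_eq_one S (S ⧸ maximalIdeal S)]
  exact length_quotient_anti h

theorem length_quotient_le_add_length {I : Ideal S} {rs : List S}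
    (hrs : ∀ x ∈ rs, x ∈ maximalIdeal S) :
    Module.length S (S ⧸ maximalIdeal S ^ 2 ⊔ I) ≤
      Module.length S (S ⧸ maximalIdeal S ^ 2 ⊔ (I ⊔ Ideal.ofList rs)) + rs.length := by
  induction rs generalizing I with
  | nil =>
    rw [Ideal.ofList_nil, sup_bot_eq]
    simp
  | cons x rs ih =>
    have h1 := length_quotient_le_add_one (B := maximalIdeal S ^ 2 ⊔ I) (x := x) fun c hc =>
      Ideal.mem_sup_left (by
        rw [pow_two]
        exact Ideal.mul_mem_mul (hrs x List.mem_cons_self) hc)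
    have h2 := ih (I := I ⊔ Ideal.span {x}) fun y hy => hrs y (List.mem_cons_of_mem _ hy)
    rw [sup_assoc] at h1
    rw [Ideal.ofList_cons, ← sup_assoc I, List.length_cons, Nat.cast_add, Nat.cast_one, ← add_assoc]
    exact h1.trans (by gcongr)

theorem length_quotient_sq [IsNoetherianRing S] :
    Module.length S (S ⧸ maximalIdeal S ^ 2) = (maximalIdeal S).spanFinrank + 1 := by
  have : IsSimpleModule S (S ⧸ maximalIdeal S) := isSimpleModule_iff_isCoatom.mpr
    (maximalIdeal.isMaximal S).out
  have hle : maximalIdeal S ^ 2 ≤ maximalIdeal S := Ideal.pow_le_self two_ne_zero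
  rw [Module.length_eq_add_of_exact (maximalIdeal S).cotangentToQuotientSquare
    (Submodule.factor hle) (maximalIdeal S).cotangentToQuotientSquare_injective
    (Submodule.factor_surjective hle) ?_, Module.length_eq_one S (S ⧸ maximalIdeal S),
    spanFinrank_maximalIdeal_eq_finrank_cotangentSpace,
    Module.length_eq_of_surjective (M := (maximalIdeal S).Cotangent)
      (residue_surjective (R := S)), ← Module.length_eq_finrank]
  rintro ⟨c⟩
  constructor
  · intro hc
    have hc : c ∈ maximalIdeal S := (Submodule.Quotient.mk_eq_zero _).mp hc
    exact ⟨(maximalIdeal S).toCotangent ⟨c, hc⟩, rfl⟩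
  · rintro ⟨y, hy⟩
    obtain ⟨z, rfl⟩ := Ideal.toCotangent_surjective _ y
    rw [← hy]
    exact (Submodule.Quotient.mk_eq_zero _).mpr z.2

theorem krullDimLE_zero_quotient {J : Ideal S} {n : ℕ} (hJ : maximalIdeal S ^ n ≤ J) :
    Ring.KrullDimLE 0 (S ⧸ J) := by
  refine Ring.KrullDimLE.mk₀ fun P hP => ?_
  have hle : maximalIdeal S ≤ P.comap (Ideal.Quotient.mk J) := by
    refine Ideal.IsPrime.le_of_pow_le (n := n) fun c hc => ?_
    rw [Ideal.mem_comap, Ideal.Quotient.eq_zero_iff_mem.mpr (hJ hc)]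
    exact zero_mem P
  have hmax : (P.comap (Ideal.Quotient.mk J)).IsMaximal := by
    rw [← (maximalIdeal.isMaximal S).eq_of_le (Ideal.IsPrime.comap _).ne_top hle]
    infer_instance
  have h := Ideal.map_eq_top_or_isMaximal_of_surjective (Ideal.Quotient.mk J)
    Ideal.Quotient.mk_surjective hmax
  rw [Ideal.map_comap_of_surjective _ Ideal.Quotient.mk_surjective P] at h
  exact h.resolve_left hP.ne_top

theorem length_quotient_pow_ne_top [IsNoetherianRing S] (n : ℕ) :
    Module.length S (S ⧸ maximalIdeal S ^ n) ≠ ⊤ := by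
  have := krullDimLE_zero_quotient (le_refl (maximalIdeal S ^ n))
  have := IsNoetherianRing.isArtinianRing_of_krullDimLE_zero (R := S ⧸ maximalIdeal S ^ n)
  rw [Module.length_eq_of_surjective (M := S ⧸ maximalIdeal S ^ n)
    (Ideal.Quotient.mk_surjective (I := maximalIdeal S ^ n))]
  exact Module.length_ne_top

theorem IsSuperficialSequence.forall_mem {I : Ideal S} {rs : List S}
    (h : IsSuperficialSequence I rs) : ∀ x ∈ rs, x ∈ maximalIdeal S := by
  induction rs generalizing I with
  | nil => simp
  | cons x rs ih =>
    rw [List.forall_mem_cons]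
    exact ⟨h.1, ih h.2.2.2.2⟩

/-- The Hilbert function of a ring modulo a superficial sequence bounds that of the ring. -/
theorem IsSuperficialSequence.exists_length_mul_choose_le {I : Ideal S} {rs : List S}
    (h : IsSuperficialSequence I rs) {C : ℕ}
    (hC : maximalIdeal S ^ C ≤ I ⊔ Ideal.ofList rs) :
    ∃ C, ∀ j : ℕ, Module.length S (S ⧸ I ⊔ Ideal.ofList rs) * (j.choose rs.length : ℕ) ≤
      Module.length S (S ⧸ maximalIdeal S ^ (C + j) ⊔ I) := by
  induction rs generalizing I with
  | nil =>
    refine ⟨C, fun j => ?_⟩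
    rw [Ideal.ofList_nil, sup_bot_eq] at hC ⊢
    rw [List.length_nil, Nat.choose_zero_right, Nat.cast_one, mul_one]
    exact length_quotient_anti (sup_le ((Ideal.pow_le_pow_right (Nat.le_add_right C j)).trans hC) le_rfl)
  | cons x rs ih =>
    obtain ⟨hx, -, -, ⟨j₀, hj₀⟩, h⟩ := h
    rw [Ideal.ofList_cons, ← sup_assoc] at hC ⊢
    obtain ⟨C₁, hC₁⟩ := ih h hC
    refine ⟨max C₁ j₀, fun j => ?_⟩
    induction j with
    | zero => simp
    | succ j hj =>
      -- Past j₀, superficiality gives (𝔪^{i+1} + I : x) = 𝔪^i + I. So length(S/(𝔪^i + I)) grows at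
      -- each step by the same length for I + (x), which matches Pascal's rule.
      have h1 := length_quotient_add (A := maximalIdeal S ^ (max C₁ j₀ + j) ⊔ I)
        (B := maximalIdeal S ^ (max C₁ j₀ + j + 1) ⊔ I) (x := x) fun c =>
          ⟨hj₀ _ (by omega) c, fun hc => by
            obtain ⟨a, ha, b, hb, rfl⟩ := Submodule.mem_sup.mp hc
            rw [mul_add, pow_succ']
            exact add_mem (Ideal.mem_sup_left (Ideal.mul_mem_mul hx ha))
              (Ideal.mem_sup_right (Ideal.mul_mem_left _ _ hb))⟩
      have h2 := hC₁ (max C₁ j₀ + j + 1 - C₁)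
      rw [show C₁ + (max C₁ j₀ + j + 1 - C₁) = max C₁ j₀ + j + 1 by omega, ← sup_assoc] at h2
      have h3 : j.choose rs.length ≤ (max C₁ j₀ + j + 1 - C₁).choose rs.length :=
        Nat.choose_le_choose _ (by omega)
      rw [List.length_cons, Nat.choose_succ_succ, Nat.cast_add, mul_add, ← add_assoc, ← h1,
        add_comm]
      gcongr
      · exact hj
      · refine le_trans ?_ h2
        gcongr

end Length

/-- The binomial coefficient is asymptotic to j^d / d!, and the shift by C does not affect leading
terms. -/
theorem le_of_tendsto_factorial_mul_div_pow {l C d : ℕ} {a : ℕ → ℕ} {e : ℝ}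
    (h : ∀ j, l * j.choose d ≤ a (C + j))
    (ha : Filter.Tendsto (fun n : ℕ => (d.factorial : ℝ) * (a n : ℝ) / (n : ℝ) ^ d)
      Filter.atTop (nhds e)) : (l : ℝ) ≤ e := by
  have h1 : Filter.Tendsto (fun n : ℕ => (l : ℝ) * (((n : ℝ) - ((C : ℝ) + d)) / (n : ℝ)) ^ d)
      Filter.atTop (nhds (l * 1 ^ d)) := by
    refine Filter.Tendsto.const_mul _ (Filter.Tendsto.pow ?_ d)
    have h0 := tendsto_const_div_atTop_nhds_zero_nat ((C : ℝ) + d)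
    have : Filter.Tendsto (fun n : ℕ => 1 - ((C : ℝ) + d) / (n : ℝ)) Filter.atTop (nhds 1) := by
      simpa using h0.const_sub 1
    refine this.congr' ?_
    filter_upwards [Filter.eventually_gt_atTop 0] with n hn
    have : (n : ℝ) ≠ 0 := by positivity
    field_simp
  rw [one_pow, mul_one] at h1
  refine le_of_tendsto_of_tendsto h1 ha ?_
  filter_upwards [Filter.eventually_ge_atTop (C + d + 1)] with n hn
  rw [div_pow, ← mul_div_assoc]
  refine div_le_div_of_nonneg_right ?_ (by positivity)
  have h2 := h (n - C)
  rw [show C + (n - C) = n by omega] at h2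
  have h3 := Nat.pow_sub_le_descFactorial (n - C) d
  rw [Nat.descFactorial_eq_factorial_mul_choose] at h3
  have h4 : ((n : ℝ) - ((C : ℝ) + d)) ^ d ≤ ((n - C + 1 - d : ℕ) : ℝ) ^ d := by
    have : ((n : ℝ) - ((C : ℝ) + d)) = ((n - (C + d) : ℕ) : ℝ) := by
      rw [Nat.cast_sub (by omega)]
      push_cast
      ring
    rw [this]
    gcongr ((?_ : ℕ) : ℝ) ^ d
    omega
  calc (l : ℝ) * ((n : ℝ) - ((C : ℝ) + d)) ^ d
      ≤ l * (d.factorial * (n - C).choose d) := by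
        gcongr
        exact h4.trans (mod_cast h3)
    _ = d.factorial * ((l * (n - C).choose d : ℕ) : ℝ) := by
        push_cast
        ring
    _ ≤ d.factorial * a n := by gcongr

section Reduction

variable {R S : Type u} [CommRing R] [IsLocalRing R] [IsNoetherianRing R] [CommRing S]
  [IsLocalRing S] [IsNoetherianRing S] [Algebra R S] [Module.Flat R S]

omit [IsNoetherianRing R] [IsNoetherianRing S] in
theorem length_quotient_pow_eq (hm : (maximalIdeal R).map (algebraMap R S) = maximalIdeal S)
    (n : ℕ) : Module.length S (S ⧸ maximalIdeal S ^ n) =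
      Module.length R (R ⧸ maximalIdeal R ^ n) := by
  have : IsLocalHom (algebraMap R S) :=
    ((IsLocalRing.local_hom_TFAE (algebraMap R S)).out 2 0).mp hm.le
  have : IsSimpleModule S (S ⧸ maximalIdeal S) := isSimpleModule_iff_isCoatom.mpr
    (maximalIdeal.isMaximal S).out
  rw [← hm, ← Ideal.map_pow,
    (Algebra.TensorProduct.quotIdealMapEquivTensorQuot S
      (maximalIdeal R ^ n)).toLinearEquiv.length_eq, IsLocalRing.length_baseChange, hm,
    Module.length_eq_one S (S ⧸ maximalIdeal S), mul_one]

omit [IsNoetherianRing S] in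
/-- Over a ring of minimal multiplicity, the ideal generated by a superficial sequence of length
`dim R` which is primary to the maximal ideal contains the square of the maximal ideal. -/
theorem IsSuperficialSequence.maximalIdeal_sq_le
    (hm : (maximalIdeal R).map (algebraMap R S) = maximalIdeal S)
    (hmin : HasMinimalMultiplicity R) {rs : List S} (hrs : IsSuperficialSequence ⊥ rs)
    (hlen : (rs.length : WithBot ℕ∞) = ringKrullDim R) {C : ℕ}
    (hC : maximalIdeal S ^ C ≤ Ideal.ofList rs) :
    maximalIdeal S ^ 2 ≤ Ideal.ofList rs := by
  obtain ⟨d, hd, d', hd', hlim⟩ := hmin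
  obtain rfl : rs.length = d' := by exact_mod_cast hlen.trans hd'
  obtain rfl : rs.length = d := by exact_mod_cast hlen.trans hd
  have hfin (n) : Module.length S (S ⧸ maximalIdeal S ^ n) ≠ ⊤ := by
    rw [length_quotient_pow_eq hm]
    exact length_quotient_pow_ne_top n
  have hfin' : Module.length S (S ⧸ Ideal.ofList rs) ≠ ⊤ :=
    ne_top_of_le_ne_top (hfin C) (length_quotient_anti hC)
  obtain ⟨C', hC'⟩ := hrs.exists_length_mul_choose_le (C := C) (by simpa using hC)
  have h1 := le_of_tendsto_factorial_mul_div_pow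
    (l := (Module.length S (S ⧸ Ideal.ofList rs)).toNat) (C := C') (fun j => by
      have h := hC' j
      rw [bot_sup_eq, sup_bot_eq] at h
      rw [← length_quotient_pow_eq hm]
      have h2 := hfin (C' + j)
      lift Module.length S (S ⧸ Ideal.ofList rs) to ℕ using hfin' with l
      lift Module.length S (S ⧸ maximalIdeal S ^ (C' + j)) to ℕ using h2 with m
      simpa using mod_cast h) hlim
  have h2 : Module.length S (S ⧸ maximalIdeal S ^ 2) = (maximalIdeal R).spanFinrank + 1 := by
    rw [length_quotient_pow_eq hm, length_quotient_sq]
  have h3 := length_quotient_le_add_length (I := ⊥) hrs.forall_mem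
  rw [sup_bot_eq, bot_sup_eq, h2] at h3
  have h4 := length_quotient_anti (A := Ideal.ofList rs)
    (B := maximalIdeal S ^ 2 ⊔ Ideal.ofList rs) le_sup_right
  have hfin'' := ne_top_of_le_ne_top hfin' h4
  -- The estimates `h1` and `h3` give length(S/rs) ≤ μ(𝔪) - d + 1 ≤ length(S/(𝔪² + rs)), so the two
  -- ideals coincide.
  refine right_eq_sup.mp (eq_of_length_quotient_le le_sup_right hfin'' ?_)
  clear h4
  lift Module.length S (S ⧸ Ideal.ofList rs) to ℕ using hfin' with l
  lift Module.length S (S ⧸ maximalIdeal S ^ 2 ⊔ Ideal.ofList rs) to ℕ using hfin'' with m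
  norm_cast at h3 ⊢
  rw [ENat.toNat_natCast, sub_add_eq_add_sub, le_sub_iff_add_le] at h1
  norm_cast at h1
  omega

end Reduction

/-! ### Existence of superficial sequences -/

section Avoidance

variable {S : Type*} [CommRing S] [IsLocalRing S] [IsNoetherianRing S]

theorem maximalIdeal_le_of_le_sq_sup {V : Ideal S}
    (h : maximalIdeal S ≤ maximalIdeal S ^ 2 ⊔ V) : maximalIdeal S ≤ V := by
  refine Submodule.le_of_le_smul_of_le_jacobson_bot (I := maximalIdeal S)
    (IsNoetherian.noetherian _) (IsLocalRing.jacobson_eq_maximalIdeal _ bot_ne_top).ge ?_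
  rwa [smul_eq_mul, ← pow_two, sup_comm]

/-- Avoidance of arbitrary ideals over a local ring with infinite residue field. -/
theorem exists_mem_maximalIdeal_forall_notMem [Infinite (ResidueField S)] {T : Set (Ideal S)}
    (hT : T.Finite) (h : ∀ V ∈ T, ¬ maximalIdeal S ≤ V) :
    ∃ x ∈ maximalIdeal S, ∀ V ∈ T, x ∉ V := by
  by_contra! hcon
  let p (V : Ideal S) : Submodule S (maximalIdeal S) :=
    Submodule.comap (maximalIdeal S).subtype (maximalIdeal S ^ 2 ⊔ V)
  have hcov : ⋃ V ∈ hT.toFinset, (p V : Set (maximalIdeal S)) = Set.univ := by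
    refine Set.eq_univ_of_forall fun x => ?_
    obtain ⟨V, hV, hx⟩ := hcon x x.2
    exact Set.mem_biUnion (hT.mem_toFinset.mpr hV) (Ideal.mem_sup_right hx)
  -- By Neumann's lemma a member of a finite cover by subgroups has finite index. The quotient of 𝔪
  -- by it is nonzero by Nakayama, so it contains a copy of the infinite residue field.
  obtain ⟨V, hV, hfin⟩ := Submodule.exists_finiteIndex_of_cover hcov
  have : Finite (maximalIdeal S ⧸ p V) := AddSubgroup.finite_quotient_of_finiteIndex
  have hlt := h V (hT.mem_toFinset.mp hV)
  obtain ⟨e, he, heV⟩ := Set.not_subset.mp fun h' => hlt (maximalIdeal_le_of_le_sq_sup h')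
  let f : S →ₗ[S] (maximalIdeal S ⧸ p V) :=
    (p V).mkQ ∘ₗ LinearMap.toSpanSingleton S _ ⟨e, he⟩
  have hf (s : S) : f s = 0 ↔ s * e ∈ maximalIdeal S ^ 2 ⊔ V :=
    Submodule.Quotient.mk_eq_zero (p V)
  have hker (s : S) : f s = 0 ↔ s ∈ maximalIdeal S := by
    rw [hf]
    refine ⟨fun hse => ?_, fun hs => Ideal.mem_sup_left (by
      rw [pow_two]; exact Ideal.mul_mem_mul hs he)⟩
    by_contra hs
    have hu : IsUnit s := by simpa using hs
    exact heV ((Ideal.unit_mul_mem_iff_mem _ hu).mp hse)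
  have : Function.Injective (Submodule.liftQ (maximalIdeal S) f fun s hs => (hker s).mpr hs) := by
    rw [← LinearMap.ker_eq_bot]
    exact Submodule.ker_liftQ_eq_bot _ _ _ fun s hs => (hker s).mp hs
  have : Finite (ResidueField S) := Finite.of_injective _ this
  exact not_finite (ResidueField S)

end Avoidance

section AssociatedPrimes

/-- T consists of the associated primes of A/J: annihilators of elements whose union is the set of
zero divisors. -/
theorem exists_finite_forall_mul_mem {A : Type*} [CommRing A] [IsNoetherianRing A] (J : Ideal A) :
    ∃ T : Set (Ideal A), T.Finite ∧ (∀ P ∈ T, ∃ f ∉ J, ∀ g, g ∈ P ↔ g * f ∈ J) ∧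
      ∀ y, (∀ P ∈ T, y ∉ P) → ∀ f, y * f ∈ J → f ∈ J := by
  refine ⟨associatedPrimes A (A ⧸ J), associatedPrimes.finite A _, fun P hP => ?_, fun y hy => ?_⟩
  · obtain ⟨hprime, x, hx⟩ := isAssociatedPrime_iff.mp hP
    obtain ⟨f, rfl⟩ := Submodule.mkQ_surjective J x
    have hf (g : A) : g ∈ P ↔ g * f ∈ J := by
      rw [hx, Submodule.mem_colon_singleton, Submodule.mem_bot, ← map_smul, Submodule.mkQ_apply,
        Submodule.Quotient.mk_eq_zero, smul_eq_mul]
    refine ⟨f, fun hfJ => hprime.ne_top ((Ideal.eq_top_iff_one _).mpr ((hf 1).mpr ?_)), hf⟩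
    rwa [one_mul]
  · have hreg : IsSMulRegular (A ⧸ J) y := by
      by_contra hreg
      have : y ∈ ⋃ p ∈ associatedPrimes A (A ⧸ J), (p : Set A) := by
        rw [biUnion_associatedPrimes_eq_compl_regular]
        exact hreg
      obtain ⟨P, hP, hyP⟩ := Set.mem_iUnion₂.mp this
      exact hy P hP hyP
    intro f hf
    refine (Submodule.Quotient.mk_eq_zero J).mp (hreg ?_)
    simp only [smul_zero]
    exact (Submodule.Quotient.mk_eq_zero J).mpr hf

end AssociatedPrimes

section Superficial

open Polynomial

variable {S : Type u} [CommRing S] [IsLocalRing S]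

omit [IsLocalRing S] in
theorem mul_mem_pow_sup {I J : Ideal S} {a c : S} {m n k : ℕ} (ha : a ∈ J ^ m)
    (hc : c ∈ J ^ n ⊔ I) (hk : k ≤ m + n) : a * c ∈ J ^ k ⊔ I := by
  obtain ⟨e, he, b, hb, rfl⟩ := Submodule.mem_sup.mp hc
  rw [mul_add]
  refine add_mem (Ideal.mem_sup_left (Ideal.pow_le_pow_right hk ?_))
    (Ideal.mem_sup_right (Ideal.mul_mem_left _ _ hb))
  rw [pow_add]
  exact Ideal.mul_mem_mul ha he

omit [IsLocalRing S] in
theorem forall_mem_pow_mul_mem {I J : Ideal S} {c : S} {a b k : ℕ}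
    (h : ∀ x ∈ J ^ a, ∀ y ∈ J ^ b, x * y * c ∈ J ^ k ⊔ I) :
    ∀ z ∈ J ^ (a + b), z * c ∈ J ^ k ⊔ I := by
  intro z hz
  rw [pow_add] at hz
  refine Submodule.mul_induction_on hz h fun x y hx hy => ?_
  rw [add_mul]
  exact add_mem hx hy

/-- The ideal of the Rees algebra of the maximal ideal consisting of the elements which are sent
to zero in the associated graded ring of `S ⧸ I` by a power of the irrelevant ideal. -/
def reesTorsion (I : Ideal S) : Ideal (reesAlgebra (maximalIdeal S)) where
  carrier := {f | ∃ N : ℕ, ∀ u, ∀ a ∈ maximalIdeal S ^ N,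
    a * (f : S[X]).coeff u ∈ maximalIdeal S ^ (N + u + 1) ⊔ I}
  zero_mem' := ⟨0, fun u a _ => by simp⟩
  add_mem' := by
    rintro f g ⟨N, hN⟩ ⟨M, hM⟩
    refine ⟨N + M, fun u a ha => ?_⟩
    refine forall_mem_pow_mul_mem (fun x hx y hy => ?_) a ha
    have h1 := mul_mem_pow_sup (k := N + M + u + 1) hy (hN u x hx) (by omega)
    have h2 := mul_mem_pow_sup (k := N + M + u + 1) hx (hM u y hy) (by omega)
    have : x * y * ((f + g : reesAlgebra (maximalIdeal S)) : S[X]).coeff u =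
        y * (x * (f : S[X]).coeff u) + x * (y * (g : S[X]).coeff u) := by
      simp only [Subalgebra.coe_add, coeff_add]
      ring
    rw [this]
    exact add_mem h1 h2
  smul_mem' := by
    rintro g f ⟨N, hN⟩
    refine ⟨N, fun u a ha => ?_⟩
    simp only [smul_eq_mul, Subalgebra.coe_mul, coeff_mul, Finset.mul_sum]
    refine sum_mem fun p hp => ?_
    have hp := Finset.HasAntidiagonal.mem_antidiagonal.mp hp
    rw [mul_left_comm]
    exact mul_mem_pow_sup (g.2 p.1) (hN p.2 a ha) (by omega)

/-- The element `a t ^ n` of the Rees algebra. -/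
noncomputable def reesMonomial (n : ℕ) {a : S} (ha : a ∈ maximalIdeal S ^ n) : reesAlgebra (maximalIdeal S) :=
  ⟨monomial n a, reesAlgebra.monomial_mem.mpr ha⟩

theorem coeff_reesMonomial_mul {n : ℕ} {a : S} (ha : a ∈ maximalIdeal S ^ n)
    (f : reesAlgebra (maximalIdeal S)) (u : ℕ) :
    ((reesMonomial n ha * f : reesAlgebra (maximalIdeal S)) : S[X]).coeff (u + n) =
      a * (f : S[X]).coeff u :=
  coeff_monomial_mul _ _ _ _

theorem coeff_reesMonomial {n : ℕ} {a : S} (ha : a ∈ maximalIdeal S ^ n) :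
    (reesMonomial n ha : S[X]).coeff n = a :=
  coeff_monomial_same _ _

variable [IsNoetherianRing S]

/-- In large degrees there is no torsion. -/
theorem exists_forall_coeff_mem_of_mem_reesTorsion (I : Ideal S) :
    ∃ u₀, ∀ f ∈ reesTorsion I, ∀ u, u₀ ≤ u →
      (f : S[X]).coeff u ∈ maximalIdeal S ^ (u + 1) ⊔ I := by
  obtain ⟨s, hs⟩ := IsNoetherian.noetherian (reesTorsion I)
  have hmem (f) (hf : f ∈ s) : f ∈ reesTorsion I := hs ▸ Submodule.subset_span hf
  choose N hN using hmem
  -- In degree at least B, any coefficient multiplying a generator f has degree at least `N f`,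
  -- enough to push the product into the next power.
  obtain ⟨B, hB⟩ : ∃ B, ∀ f (hf : f ∈ s), N f hf + (f : S[X]).natDegree ≤ B :=
    ⟨s.attach.sup fun f => N f.1 f.2 + (f.1 : S[X]).natDegree, fun f hf =>
      Finset.le_sup (f := fun f : s => N f.1 f.2 + (f.1 : S[X]).natDegree)
        (Finset.mem_attach s ⟨f, hf⟩)⟩
  refine ⟨B, fun f hf u hu => ?_⟩
  rw [← hs] at hf
  induction hf using Submodule.closure_induction with
  | zero => simp
  | add x y _ _ hx hy => simpa using add_mem hx hy
  | smul_mem g f hf =>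
    simp only [smul_eq_mul, Subalgebra.coe_mul, coeff_mul]
    refine sum_mem fun p hp => ?_
    have hp := Finset.HasAntidiagonal.mem_antidiagonal.mp hp
    by_cases hd : (f : S[X]).natDegree < p.2
    · rw [coeff_eq_zero_of_natDegree_lt hd, mul_zero]
      exact zero_mem _
    · have h1 := hB f hf
      obtain ⟨v, hv⟩ : ∃ v, p.1 = v + N f hf := ⟨p.1 - N f hf, by omega⟩
      refine forall_mem_pow_mul_mem (a := v) (b := N f hf) (fun x hx y hy => ?_) _
        (by rw [← hv]; exact g.2 p.1)
      rw [mul_assoc]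
      exact mul_mem_pow_sup hx (hN f hf p.2 y hy) (by omega)

/-- Elements of the maximal ideal outside of finitely many ideals are superficial. -/
theorem exists_finite_forall_notMem_superficial (I : Ideal S) :
    ∃ T : Set (Ideal S), T.Finite ∧ (∀ V ∈ T, ¬ maximalIdeal S ≤ V) ∧
      ∀ x ∈ maximalIdeal S, (∀ V ∈ T, x ∉ V) → ∃ j₀, ∀ j, j₀ ≤ j → ∀ c ∈ maximalIdeal S ^ j,
        x * c ∈ maximalIdeal S ^ (j + 2) ⊔ I → c ∈ maximalIdeal S ^ (j + 1) ⊔ I := by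
  obtain ⟨u₀, hu₀⟩ := exists_forall_coeff_mem_of_mem_reesTorsion I
  obtain ⟨T, hTfin, hT, hTmem⟩ := exists_finite_forall_mul_mem (reesTorsion I)
  let Φ : maximalIdeal S →ₗ[S] reesAlgebra (maximalIdeal S) :=
    { toFun a := reesMonomial 1 (by rw [pow_one]; exact a.2)
      map_add' a b := Subtype.ext (by simp [reesMonomial])
      map_smul' s a := Subtype.ext (by simp [reesMonomial, smul_monomial]) }
  -- The degree-one forms in P, regarded as elements of 𝔪.
  let V (P : Ideal (reesAlgebra (maximalIdeal S))) : Ideal S :=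
    ((P.restrictScalars S).comap Φ).map (maximalIdeal S).subtype
  have hV (P : Ideal (reesAlgebra (maximalIdeal S))) (x : S) (hx : x ∈ maximalIdeal S) :
      x ∈ V P ↔ Φ ⟨x, hx⟩ ∈ P := by
    constructor
    · rintro ⟨y, hy, rfl⟩
      exact hy
    · exact fun h => ⟨⟨x, hx⟩, h, rfl⟩
  refine ⟨V '' T, hTfin.image V, ?_, ?_⟩
  · rintro _ ⟨P, hP, rfl⟩ hle
    obtain ⟨f, hfJ, hf⟩ := hT P hP
    -- If P contained all degree-one forms, each would carry f into the torsion. The uniform bound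
    -- u₀ then makes f itself torsion, against the choice of f.
    refine hfJ ⟨u₀ + 1, fun u => forall_mem_pow_mul_mem fun a ha b hb => ?_⟩
    have hb' : b ∈ maximalIdeal S := by simpa using hb
    have h1 := (hf _).mp ((hV P b hb').mp (hle hb'))
    have h2 := hu₀ _ (Ideal.mul_mem_left _ (reesMonomial u₀ ha) h1) (u + 1 + u₀) (by omega)
    rw [coeff_reesMonomial_mul] at h2
    have h3 := coeff_reesMonomial_mul hb f u
    rw [show u₀ + 1 + u + 1 = u + 1 + u₀ + 1 by omega, mul_assoc, ← h3]
    exact h2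
  · intro x hx hxT
    refine ⟨u₀, fun j hj c hc hxc => ?_⟩
    -- The product of x t and c t^j is torsion. As x t avoids the associated primes of the torsion
    -- ideal, c t^j is torsion, and large degrees carry no torsion.
    have hmem : Φ ⟨x, hx⟩ * reesMonomial j hc ∈ reesTorsion I := by
      refine ⟨0, fun u a _ => ?_⟩
      have : ((Φ ⟨x, hx⟩ * reesMonomial j hc : reesAlgebra (maximalIdeal S)) : S[X]) =
          monomial (1 + j) (x * c) := monomial_mul_monomial _ _ _ _
      rw [this, coeff_monomial]
      split_ifs with hu
      · subst hu
        rw [show 0 + (1 + j) + 1 = j + 2 by omega]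
        exact Ideal.mul_mem_left _ _ hxc
      · simp
    have h1 : reesMonomial j hc ∈ reesTorsion I :=
      hTmem _ (fun P hP hxP => hxT _ ⟨P, hP, rfl⟩ ((hV P x hx).mpr hxP)) _ hmem
    simpa [coeff_reesMonomial] using hu₀ _ h1 j hj

omit [IsLocalRing S] [IsNoetherianRing S] in
theorem mk_mem_smul_top_iff {I J : Ideal S} {c : S} :
    (Submodule.Quotient.mk c : S ⧸ I) ∈ J • (⊤ : Submodule S (S ⧸ I)) ↔ c ∈ J ⊔ I := by
  have h : J • (⊤ : Submodule S (S ⧸ I)) = Submodule.map (Submodule.mkQ I) J := by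
    rw [← Submodule.range_mkQ I, LinearMap.range_eq_map, ← Submodule.map_smul'', smul_eq_mul,
      Ideal.mul_top]
  rw [h, ← Submodule.mkQ_apply, ← Submodule.mem_comap, Submodule.comap_map_mkQ, sup_comm]

/-- Artin–Rees and regularity of x put c in 𝔪^{j+1-k} + I for a constant k. From there the
hypothesis on x raises the exponent one step at a time up to j. -/
theorem exists_forall_mem_of_mul_mem {I : Ideal S} {x : S} (hreg : ∀ c, x * c ∈ I → c ∈ I)
    (hx : ∃ j₀, ∀ j, j₀ ≤ j → ∀ c ∈ maximalIdeal S ^ j,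
        x * c ∈ maximalIdeal S ^ (j + 2) ⊔ I → c ∈ maximalIdeal S ^ (j + 1) ⊔ I) :
    ∃ j₀, ∀ j, j₀ ≤ j → ∀ c, x * c ∈ maximalIdeal S ^ (j + 1) ⊔ I →
        c ∈ maximalIdeal S ^ j ⊔ I := by
  obtain ⟨j₀, hj₀⟩ := hx
  let N : Submodule S (S ⧸ I) := LinearMap.range (LinearMap.lsmul S (S ⧸ I) x)
  obtain ⟨k, hk⟩ := (maximalIdeal S).exists_pow_inf_eq_pow_smul N
  refine ⟨j₀ + k, fun j hj c hc => ?_⟩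
  have hstart : c ∈ maximalIdeal S ^ (j + 1 - k) ⊔ I := by
    have h1 : (Submodule.Quotient.mk (x * c) : S ⧸ I) ∈
        maximalIdeal S ^ (j + 1) • (⊤ : Submodule S (S ⧸ I)) ⊓ N :=
      ⟨mk_mem_smul_top_iff.mpr hc, ⟨Submodule.Quotient.mk c, rfl⟩⟩
    rw [hk _ (by omega)] at h1
    have h2 := Submodule.smul_mono (le_refl (maximalIdeal S ^ (j + 1 - k))) inf_le_right h1
    rw [show N = Submodule.map (LinearMap.lsmul S (S ⧸ I) x) ⊤ from
      (Submodule.map_top _).symm, ← Submodule.map_smul''] at h2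
    obtain ⟨⟨c'⟩, hc', hcc'⟩ := h2
    have h3 : c' ∈ maximalIdeal S ^ (j + 1 - k) ⊔ I := mk_mem_smul_top_iff.mp hc'
    have h4 : x * c' - x * c ∈ I := (Submodule.Quotient.eq I).mp hcc'
    have h5 := hreg (c' - c) (by rwa [mul_sub])
    have : c = c' - (c' - c) := by ring
    rw [this]
    exact sub_mem h3 (Ideal.mem_sup_right h5)
  have hstep (i : ℕ) (hi : j₀ ≤ i) (hij : i ≤ j) : c ∈ maximalIdeal S ^ i ⊔ I := by
    induction i, hi using Nat.le_induction with
    | base => exact sup_le_sup_right (Ideal.pow_le_pow_right (by omega)) I hstart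
    | succ i hi ih =>
      obtain ⟨a, ha, b, hb, rfl⟩ := Submodule.mem_sup.mp (ih (by omega))
      refine add_mem (hj₀ i hi a ha ?_) (Ideal.mem_sup_right hb)
      have : x * a = x * (a + b) - x * b := by ring
      rw [this]
      exact sub_mem (sup_le_sup_right (Ideal.pow_le_pow_right (by omega)) I hc)
        (Ideal.mem_sup_right (Ideal.mul_mem_left _ _ hb))
  exact hstep j (by omega) le_rfl

end Superficial

section Existence

open scoped Pointwise

variable {S : Type u} [CommRing S] [IsLocalRing S] [IsNoetherianRing S]

theorem not_maximalIdeal_le_of_isAssociatedPrime {W : Type u} [AddCommGroup W] [Module S W]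
    (h : Subsingleton (ExtModule S (ResidueField S) W 0)) {P : Ideal S}
    (hP : P ∈ associatedPrimes S W) : ¬ maximalIdeal S ≤ P := by
  intro hle
  obtain ⟨hprime, f, hf⟩ := (isAssociatedPrime_iff_exists_injective_linearMap P W).mp hP
  obtain rfl := (maximalIdeal.isMaximal S).eq_of_le hprime.ne_top hle
  have := subsingleton_ext_zero_iff.mp h
  have h0 : f = 0 := Subsingleton.elim (α := ResidueField S →ₗ[S] W) f 0
  have : (1 : ResidueField S) = 0 := hf (by rw [h0]; rfl)
  exact one_ne_zero this

omit [IsNoetherianRing S] in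
theorem subsingleton_ext_quotSMulTop {W : Type u} [AddCommGroup W] [Module S W] {x : S}
    (hx : IsSMulRegular W x) {c : ℕ}
    (h : ∀ i < c + 1, Subsingleton (ExtModule S (ResidueField S) W i)) :
    ∀ i < c, Subsingleton (ExtModule S (ResidueField S) (QuotSMulTop x W) i) := by
  intro i hi
  have hr : LinearMap.range (LinearMap.lsmul S W x) = x • (⊤ : Submodule S W) :=
    LinearMap.range_eq_map _
  refine subsingleton_ext_right_of_covariant (f := LinearMap.lsmul S W x)
    (g := (x • (⊤ : Submodule S W)).mkQ) hx ?_ (Submodule.mkQ_surjective _) (ResidueField S)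
    (h i (by omega)) (h (i + 1) (by omega))
  rw [← hr]
  exact LinearMap.exact_map_mkQ_range _

omit [IsNoetherianRing S] in
theorem subsingleton_ext_quotient_sup_span {I : Ideal S} {x : S}
    (hx : ∀ c, x * c ∈ I → c ∈ I) {c : ℕ}
    (h : ∀ i < c + 1, Subsingleton (ExtModule S (ResidueField S) (S ⧸ I) i)) :
    ∀ i < c, Subsingleton (ExtModule S (ResidueField S) (S ⧸ I ⊔ Ideal.span {x}) i) := by
  intro i hi
  obtain ⟨f, g, hf, hfg, hg⟩ := exists_exact_quotient (A := I) (B := I) (x := x) fun c =>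
    ⟨hx c, fun hc => Ideal.mul_mem_left _ _ hc⟩
  exact subsingleton_ext_right_of_covariant hf hfg hg (ResidueField S) (h i (by omega))
    (h (i + 1) (by omega))

/-- Superficial sequences exist when the residue field is infinite. -/
theorem exists_isSuperficialSequence [Infinite (ResidueField S)] (c : ℕ) (I : Ideal S)
    (hI : I ≤ maximalIdeal S) (W : Type u) [AddCommGroup W] [Module S W] [Module.Finite S W]
    (hSI : ∀ i < c, Subsingleton (ExtModule S (ResidueField S) (S ⧸ I) i))
    (hW : ∀ i < c, Subsingleton (ExtModule S (ResidueField S) W i)) :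
    ∃ rs : List S, rs.length = c ∧ IsSuperficialSequence I rs ∧
      RingTheory.Sequence.IsWeaklyRegular W rs := by
  induction c generalizing I W with
  | zero => exact ⟨[], rfl, trivial, RingTheory.Sequence.IsWeaklyRegular.nil S W⟩
  | succ c ih =>
    obtain ⟨T, hTfin, hT, hsup⟩ := exists_finite_forall_notMem_superficial I
    -- A single x avoids the obstructions to superficiality, to independence modulo 𝔪² + I, and to
    -- regularity on S/I and on W.
    obtain ⟨x, hx, hxT⟩ := exists_mem_maximalIdeal_forall_notMem
      (T := T ∪ {maximalIdeal S ^ 2 ⊔ I} ∪ associatedPrimes S (S ⧸ I) ∪ associatedPrimes S W)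
      (((hTfin.union (Set.finite_singleton _)).union (associatedPrimes.finite S _)).union
        (associatedPrimes.finite S W)) (by
        rintro V (((hV | rfl) | hV) | hV)
        · exact hT V hV
        · intro hle
          obtain rfl := le_antisymm hI (maximalIdeal_le_of_le_sq_sup hle)
          have : Subsingleton (ResidueField S →ₗ[S] ResidueField S) :=
            subsingleton_ext_zero_iff.mp (hSI 0 (by omega))
          exact one_ne_zero (α := ResidueField S) (LinearMap.congr_fun (Subsingleton.elim
            (α := ResidueField S →ₗ[S] ResidueField S) LinearMap.id 0) 1)
        · exact not_maximalIdeal_le_of_isAssociatedPrime (hSI 0 (by omega)) hV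
        · exact not_maximalIdeal_le_of_isAssociatedPrime (hW 0 (by omega)) hV)
    have hregular (Q : Type u) [AddCommGroup Q] [Module S Q]
        (hQ : ∀ V ∈ associatedPrimes S Q, x ∉ V) : IsSMulRegular Q x := by
      by_contra hreg
      have : x ∈ ⋃ p ∈ associatedPrimes S Q, (p : Set S) := by
        rw [biUnion_associatedPrimes_eq_compl_regular]
        exact hreg
      obtain ⟨P, hP, hxP⟩ := Set.mem_iUnion₂.mp this
      exact hQ P hP hxP
    have hxI (a : S) (ha : x * a ∈ I) : a ∈ I := by
      have h1 := hregular (S ⧸ I) fun V hV => hxT V (Or.inl (Or.inr hV))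
      refine (Submodule.Quotient.mk_eq_zero I).mp (h1 ?_)
      simp only [smul_zero]
      exact (Submodule.Quotient.mk_eq_zero I).mpr ha
    have hxW := hregular W fun V hV => hxT V (Or.inr hV)
    obtain ⟨rs, hlen, hrs, hrsW⟩ := ih (I ⊔ Ideal.span {x})
      (sup_le hI ((Ideal.span_singleton_le_iff_mem _).mpr hx)) (QuotSMulTop x W)
      (subsingleton_ext_quotient_sup_span hxI hSI) (subsingleton_ext_quotSMulTop hxW hW)
    refine ⟨x :: rs, by rw [List.length_cons, hlen], ⟨hx, hxT _ (by simp), hxI,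
      exists_forall_mem_of_mul_mem hxI (hsup x hx fun V hV => hxT V (by simp [hV])), hrs⟩,
      (RingTheory.Sequence.isWeaklyRegular_cons_iff W x rs).mpr ⟨hxW, hrsW⟩⟩

end Existence

/-! ### Enlarging the residue field -/

section InfiniteResidueField

open Polynomial

/-- A Noetherian local ring has a flat local extension with infinite residue field which is
generated by the maximal ideal. -/
theorem exists_flat_infinite_residueField (R : Type u) [CommRing R] [IsLocalRing R]
    [IsNoetherianRing R] :
    ∃ (S : Type u) (_ : CommRing S) (_ : IsLocalRing S) (_ : IsNoetherianRing S) (_ : Algebra R S),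
      Module.Flat R S ∧ Infinite (ResidueField S) ∧
        (maximalIdeal R).map (algebraMap R S) = maximalIdeal S := by
  have hprime : ((maximalIdeal R).map (C : R →+* R[X])).IsPrime :=
    Ideal.isPrime_map_C_of_isPrime
  let S := Localization.AtPrime ((maximalIdeal R).map (C : R →+* R[X]))
  have hnoeth : IsNoetherianRing S := IsLocalization.isNoetherianRing
    ((maximalIdeal R).map (C : R →+* R[X])).primeCompl S inferInstance
  have hflat : Module.Flat R[X] S := IsLocalization.flat S
    ((maximalIdeal R).map (C : R →+* R[X])).primeCompl
  refine ⟨S, inferInstance, inferInstance, hnoeth, inferInstance,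
    Module.Flat.trans R R[X] S, ?_, ?_⟩
  -- Powers of X stay distinct in the residue field, since a difference of two of them has a
  -- coefficient 1, outside 𝔪.
  · refine Infinite.of_injective
      (fun i : ℕ => residue S (algebraMap R[X] S (X ^ i))) fun i j hij => ?_
    by_contra hne
    have h1 : algebraMap R[X] S (X ^ i - X ^ j) ∈ maximalIdeal S := by
      rw [← residue_eq_zero_iff, map_sub, map_sub]
      exact sub_eq_zero.mpr hij
    have h2 := (IsLocalization.AtPrime.to_map_mem_maximal_iff S
      ((maximalIdeal R).map (C : R →+* R[X])) _).mp h1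
    have h3 := Ideal.mem_map_C_iff.mp h2 i
    rw [coeff_sub, coeff_X_pow_self, coeff_X_pow, if_neg hne, sub_zero] at h3
    exact (Ideal.ne_top_iff_one _).mp (maximalIdeal.isMaximal R).ne_top h3
  · rw [IsScalarTower.algebraMap_eq R R[X] S, ← Ideal.map_map]
    exact Localization.AtPrime.map_eq_maximalIdeal

end InfiniteResidueField

/-! ### Reduction of L modulo a superficial sequence after base change -/

section Reduction

variable {S : Type u} [CommRing S] [IsLocalRing S]

theorem IsSuperficialSequence.isWeaklyRegular {rs : List S} (h : IsSuperficialSequence ⊥ rs) :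
    RingTheory.Sequence.IsWeaklyRegular S rs := by
  have key (rs : List S) : ∀ I : Ideal S, IsSuperficialSequence I rs → ∀ i (hi : i < rs.length) c,
      rs[i] * c ∈ I ⊔ Ideal.ofList (rs.take i) → c ∈ I ⊔ Ideal.ofList (rs.take i) := by
    induction rs with
    | nil => simp
    | cons x rs ih =>
      rintro I ⟨-, -, hx, -, hrs⟩ i hi c hc
      cases i with
      | zero => simpa [Ideal.ofList_nil] using hx c (by simpa [Ideal.ofList_nil] using hc)
      | succ i =>
        rw [List.take_succ_cons, Ideal.ofList_cons, ← sup_assoc] at hc ⊢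
        exact ih _ hrs i (by simpa using hi) c (by simpa using hc)
  refine ⟨fun i hi => ?_⟩
  rw [isSMulRegular_iff_right_eq_zero_of_smul]
  rintro ⟨c⟩ hc
  have hc : rs[i] • c ∈ Ideal.ofList (rs.take i) • (⊤ : Submodule S S) :=
    (Submodule.Quotient.mk_eq_zero _).mp hc
  refine (Submodule.Quotient.mk_eq_zero _).mpr ?_
  rw [smul_eq_mul, Ideal.mul_top] at hc ⊢
  simpa using key rs ⊥ h i hi c (by simpa using hc)

variable [IsNoetherianRing S]

omit [IsNoetherianRing S] in
theorem isRegular_of_isWeaklyRegular {M : Type u} [AddCommGroup M] [Module S M] [Module.Finite S M]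
    [Nontrivial M] {rs : List S} (hrs : ∀ x ∈ rs, x ∈ maximalIdeal S)
    (h : RingTheory.Sequence.IsWeaklyRegular M rs) : RingTheory.Sequence.IsRegular M rs := by
  refine ⟨h, fun htop => ?_⟩
  have hle : Ideal.ofList rs ≤ maximalIdeal S := Ideal.span_le.mpr hrs
  have hlt := maximalIdeal_smul_top_lt (R := S) (M := M)
  exact absurd (htop.le.trans (Submodule.smul_mono hle le_rfl)) (not_le_of_gt hlt)

theorem exists_pow_maximalIdeal_le_of_isRegular {rs : List S}
    (h : RingTheory.Sequence.IsRegular S rs) (hd : ringKrullDim S = rs.length) :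
    ∃ C, maximalIdeal S ^ C ≤ Ideal.ofList rs := by
  have h1 := ringKrullDim_add_length_eq_ringKrullDim_of_isRegular rs h
  have : Ring.KrullDimLE 0 (S ⧸ Ideal.ofList rs) := by
    rw [Ring.krullDimLE_iff]
    rw [hd] at h1
    generalize ringKrullDim (S ⧸ Ideal.ofList rs) = a at h1 ⊢
    cases a with
    | bot => exact bot_le
    | coe a =>
      norm_cast at h1 ⊢
      cases a with
      | top => simp at h1
      | coe a =>
        norm_cast at h1 ⊢
        omega
  have := IsNoetherianRing.isArtinianRing_of_krullDimLE_zero (R := S ⧸ Ideal.ofList rs)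
  exact exists_maximalIdeal_pow_le_of_isArtinianRing_quotient _

theorem ringKrullDim_eq_length_of_isRegular {rs : List S}
    (h : RingTheory.Sequence.IsRegular S rs) {C : ℕ}
    (hC : maximalIdeal S ^ C ≤ Ideal.ofList rs) : ringKrullDim S = rs.length := by
  have h1 := ringKrullDim_add_length_eq_ringKrullDim_of_isRegular rs h
  have h2 := (Ring.krullDimLE_iff).mp (krullDimLE_zero_quotient hC)
  have hne : Nontrivial (S ⧸ Ideal.ofList rs) := by
    refine Ideal.Quotient.nontrivial_iff.mpr fun htop => h.top_ne_smul ?_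
    rw [htop, smul_eq_mul, Ideal.mul_top]
  have h3 : (0 : WithBot ℕ∞) ≤ ringKrullDim (S ⧸ Ideal.ofList rs) := ringKrullDim_nonneg_of_nontrivial
  rw [← h1, le_antisymm (by simpa using h2) h3, zero_add]

variable {R : Type u} [CommRing R] [IsLocalRing R] [IsNoetherianRing R]

omit [IsNoetherianRing R] in
theorem subsingleton_ext_tensorProduct [Algebra R S] [Module.Flat R S]
    (hm : (maximalIdeal R).map (algebraMap R S) = maximalIdeal S)
    {M : Type u} [AddCommGroup M] [Module R M] [Module.Finite R M] [Nontrivial M] {d : ℕ}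
    (h : depth R M = d) : ∀ i < d,
      Subsingleton (ExtModule S (ResidueField S) (TensorProduct R S M) i) := by
  intro i hi
  have : IsLocalHom (algebraMap R S) :=
    ((IsLocalRing.local_hom_TFAE (algebraMap R S)).out 2 0).mp hm.le
  have : Module.FaithfullyFlat R S := Module.FaithfullyFlat.of_flat_of_isLocalHom
  obtain ⟨rs, rfl, hrs, hreg⟩ := exists_isRegular_of_depth_eq h
  refine subsingleton_ext_of_isRegular (rs := rs.map (algebraMap R S)) ?_
    (hreg.of_faithfullyFlat_of_isBaseChange (TensorProduct.isBaseChange R M S)) (by simpa using hi)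
  intro y hy
  obtain ⟨x, hx, rfl⟩ := List.mem_map.mp hy
  rw [← hm]
  exact Ideal.mem_map_of_mem _ (hrs x hx)

/-- Over a Cohen-Macaulay ring of minimal multiplicity, a homomorphic image `L` of a direct sum of
syzygies of the residue field of maximal depth satisfies, after a flat base change,
`𝔪 L = (x₁, …, x_d) L` for an `L`-regular sequence. -/
theorem exists_flat_isRegular {d : ℕ} (hd : ringKrullDim R = d) (hR : depth R R = d)
    (hmin : HasMinimalMultiplicity R) (L : Type u) [AddCommGroup L] [Module R L]
    [Module.Finite R L] [Nontrivial L] (hL : depth R L = d)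
    (hsyz : IsImageOfResidueFieldSyzygies R L) :
    ∃ (S : Type u) (_ : CommRing S) (_ : IsLocalRing S) (_ : Algebra R S) (rs : List S),
      Module.Flat R S ∧ (maximalIdeal R).map (algebraMap R S) = maximalIdeal S ∧ rs.length = d ∧
        RingTheory.Sequence.IsRegular (TensorProduct R S L) rs ∧
        maximalIdeal S • (⊤ : Submodule S (TensorProduct R S L)) ≤ Ideal.ofList rs • ⊤ := by
  obtain ⟨S, _, _, _, _, _, _, hm⟩ := exists_flat_infinite_residueField R
  have : IsLocalHom (algebraMap R S) :=
    ((IsLocalRing.local_hom_TFAE (algebraMap R S)).out 2 0).mp hm.le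
  have : Module.FaithfullyFlat R S := Module.FaithfullyFlat.of_flat_of_isLocalHom
  have hS (i : ℕ) (hi : i < d) : Subsingleton (ExtModule S (ResidueField S) (S ⧸ (⊥ : Ideal S)) i) :=
    (subsingleton_ext_congr_right ((Submodule.quotEquivOfEqBot (⊥ : Ideal S) rfl).trans
      (TensorProduct.AlgebraTensorModule.rid R S S).symm)).mpr
      (subsingleton_ext_tensorProduct hm hR i hi)
  obtain ⟨rs, hlen, hrs, hrsL⟩ := exists_isSuperficialSequence d (⊥ : Ideal S) bot_le
    (TensorProduct R S L) hS (subsingleton_ext_tensorProduct hm hL)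
  -- A maximal regular sequence of R stays regular in S and still generates an ideal primary to the
  -- maximal ideal; this gives dim S = d.
  obtain ⟨as, has, hasm, hasreg⟩ := exists_isRegular_of_depth_eq hR
  obtain ⟨C, hC⟩ := exists_pow_maximalIdeal_le_of_isRegular hasreg (by rw [hd, has])
  have hdS : ringKrullDim S = d := by
    have h := ringKrullDim_eq_length_of_isRegular
      (hasreg.of_faithfullyFlat (S := S)) (C := C) (by
        rw [← hm, ← Ideal.map_pow, ← Ideal.map_ofList]
        exact Ideal.map_mono hC)
    rw [h, List.length_map, has]
  obtain ⟨C', hC'⟩ := exists_pow_maximalIdeal_le_of_isRegular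
    (isRegular_of_isWeaklyRegular hrs.forall_mem hrs.isWeaklyRegular) (by rw [hdS, hlen])
  have hsq := hrs.maximalIdeal_sq_le hm hmin (by rw [hd, hlen]) hC'
  exact ⟨S, inferInstance, inferInstance, inferInstance, rs, inferInstance, hm, hlen,
    isRegular_of_isWeaklyRegular hrs.forall_mem hrsL,
    maximalIdeal_smul_top_le_of_isImage hm hrs hsq hsyz⟩

end Reduction

/-! ### Vanishing of `Ext` or `Tor` kills a term of the minimal resolution -/

section Vanishing

variable {R : Type u} [CommRing R] [IsLocalRing R] [IsNoetherianRing R] {d : ℕ}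
  (hd : ringKrullDim R = d) (hR : depth R R = d) (hmin : HasMinimalMultiplicity R)
  {L : Type u} [AddCommGroup L] [Module R L] [Module.Finite R L] [Nontrivial L]
  (hL : depth R L = d) (hsyz : IsImageOfResidueFieldSyzygies R L)
  {W : Type u} [AddCommGroup W] [Module R W] (P : MinimalFreeResolution R W) {n : ℕ}

include hd hR hmin hL hsyz

theorem MinimalFreeResolution.rank_eq_zero_of_subsingleton_ext
    (h : ∀ i, n + 1 ≤ i → i ≤ n + 1 + d → Subsingleton (ExtModule R W L i)) :
    P.rank (n + 1) = 0 := by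
  obtain ⟨S, _, _, _, rs, _, hm, rfl, hreg, hle⟩ := exists_flat_isRegular hd hR hmin L hL hsyz
  refine eq_zero_of_exact_cochain P.rank
    (fun i => (P.matrix i).transpose.map (algebraMap R S)) (fun i j k => ?_) rs
    (TensorProduct R S L) n hreg hle fun i h1 h2 => ?_
  · rw [← hm]
    exact Ideal.mem_map_of_mem _ (P.matrix_mem i k j)
  · exact exact_matrixMap_baseChange S
      (P.exact_matrixMap_transpose (h (i + 1) (by omega) (by omega)))

theorem MinimalFreeResolution.rank_eq_zero_of_subsingleton_tor
    (h : ∀ i, n + 1 ≤ i → i ≤ n + 1 + d → Subsingleton (TorModule R W L i)) :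
    P.rank (n + d + 1) = 0 := by
  obtain ⟨S, _, _, _, rs, _, hm, rfl, hreg, hle⟩ := exists_flat_isRegular hd hR hmin L hL hsyz
  refine eq_zero_of_exact_chain P.rank
    (fun i => (P.matrix i).map (algebraMap R S)) (fun i j k => ?_) rs
    (TensorProduct R S L) n hreg hle fun i h1 h2 => ?_
  · rw [← hm]
    exact Ideal.mem_map_of_mem _ (P.matrix_mem i j k)
  · exact exact_matrixMap_baseChange S (P.exact_matrixMap (h (i + 1) (by omega) (by omega)))

end Vanishing

theorem depth_eq_of_isMCM {R : Type u} [CommRing R] [IsLocalRing R] {d : ℕ}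
    (hd : ringKrullDim R = d) {M : Type u} [AddCommGroup M] [Module R M] (hM : IsMCM R M) :
    depth R M = d := by
  have := hM.isCohenMacaulayModule.depth_eq
  rw [hM.dim_eq, hd] at this
  exact_mod_cast this

end CMLocal

/-! ### The equivalence -/

theorem theorem5p5 (R : Type u) [CommRing R] [IsLocalRing R] [IsNoetherianRing R]
    (d : ℕ) (hd : ringKrullDim R = d)
    (hCM : CMLocal.IsCohenMacaulayRing R)
    (hmin : CMLocal.HasMinimalMultiplicity R)
    (ω : Type u) [AddCommGroup ω] [Module R ω] (hω : CMLocal.IsCanonicalModule R ω)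
    (L : Type u) [AddCommGroup L] [Module R L] [Nontrivial L] (hL : CMLocal.IsMCM R L)
    (hsyz : CMLocal.IsImageOfResidueFieldSyzygies R L) :
    List.TFAE
      [∃ n : ℕ, 1 ≤ n ∧ ∀ i : ℕ, n ≤ i → i ≤ n + d → Subsingleton (CMLocal.ExtModule R ω L i),
        ∀ i : ℕ, 1 ≤ i → Subsingleton (CMLocal.ExtModule R ω L i),
        CMLocal.IsGorenstein R,
        ∃ n : ℕ, 1 ≤ n ∧ ∀ i : ℕ, n ≤ i → i ≤ n + d → Subsingleton (CMLocal.TorModule R ω L i),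
        ∀ i : ℕ, 1 ≤ i → Subsingleton (CMLocal.TorModule R ω L i)] := by
  have hR : CMLocal.depth R R = d :=
    CMLocal.depth_eq_of_isMCM hd ⟨hCM, Module.supportDim_self_eq_ringKrullDim R⟩
  have hLd := CMLocal.depth_eq_of_isMCM hd hL
  have := hω.finite
  have := hL.isCohenMacaulayModule.finite
  obtain ⟨P⟩ := CMLocal.nonempty_minimalFreeResolution (R := R) ω
  -- One zero term in positive degree already makes ω free; all implications pass through this.
  have hbij {n : ℕ} (h : P.rank (n + 1) = 0) : Function.Bijective P.ε :=
    P.bijective_of_rank_eq_zero hR (fun i hi => hω.subsingleton_ext hd hi.ne) h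
  have hgor {n : ℕ} (h : P.rank (n + 1) = 0) : CMLocal.IsGorenstein R :=
    CMLocal.isGorenstein_of_free hω hd (LinearEquiv.ofBijective P.ε (hbij h))
  have hfree (h : CMLocal.IsGorenstein R) : Module.Free R ω :=
    Module.Free.of_equiv (LinearEquiv.ofBijective P.ε
      (hbij (P.rank_eq_zero_of_isGorenstein hω hd hR h)))
  tfae_have 2 → 1 := fun h => ⟨1, le_rfl, fun i hi _ => h i hi⟩
  tfae_have 5 → 4 := fun h => ⟨1, le_rfl, fun i hi _ => h i hi⟩
  tfae_have 1 → 3 := by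
    rintro ⟨n, hn, h⟩
    obtain ⟨n, rfl⟩ := Nat.exists_eq_add_of_le' hn
    exact hgor (P.rank_eq_zero_of_subsingleton_ext hd hR hmin hLd hsyz h)
  tfae_have 4 → 3 := by
    rintro ⟨n, hn, h⟩
    obtain ⟨n, rfl⟩ := Nat.exists_eq_add_of_le' hn
    exact hgor (P.rank_eq_zero_of_subsingleton_tor hd hR hmin hLd hsyz h)
  tfae_have 3 → 2 := by
    intro h i hi
    have := hfree h
    obtain ⟨i, rfl⟩ := Nat.exists_eq_add_of_le' hi
    exact CMLocal.subsingleton_ext_of_projective i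
  tfae_have 3 → 5 := by
    intro h i hi
    have := hfree h
    obtain ⟨i, rfl⟩ := Nat.exists_eq_add_of_le' hi
    exact CMLocal.subsingleton_tor_of_flat i
  tfae_finish
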